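/- Let $(X,\mathcal X)$, $(Y,\mathcal Y)$ be measurable spaces and let $\Theta\subset\mathbf R^p$ be open. Let $\nu$ be a $\sigma$-finite measure on $X\times Y$ that disintegrates as $\nu(dx\,dy)=\nu_X(dx)\,\nu(dy|x)$, where $\nu_X$ is an $s$-finite measure on $X$ (for instance the $X$-marginal of $\nu$) and $\nu(dy|x)$ is an $s$-finite kernel from $X$ to $Y$. For $\theta\in\Theta$ let $P(dx\,dy|\theta)=p(xy|\theta)\,\nu(dx\,dy)$ be probability measures, where $p\ge 0$ is jointly measurable on $X\times Y\times\Theta$. Let $P(dx|\theta)$ be the $X$-marginal of $P(dx\,dy|\theta)$, put $p(x|\theta)=\int_Y p(xy|\theta)\,\nu(dy|x)$, and let $P(dy|x,\theta)$ be any probability kernel with $P(dx\,dy|\theta)=P(dx|\theta)P(dy|x,\theta)$. Assume: 1. At every $\theta\in\Theta$ the full model is quadratic mean differentiable: there is a measurable $\eta(\cdot|\theta):X\times Y\to\mathbf R^p$ with $$\int\bigl|\sqrt{p(xy|\theta+h)}-\sqrt{p(xy|\theta)}-h^T\eta(xy|\theta)\bigr|^2\,\nu(dx\,dy)=o(|h|^2)\qquad(h\to0).$$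 2. For all $\theta_1,\theta_2\in\Theta$ and all $A\in\mathcal X\otimes\mathcal Y$: $P(A|\theta_1)>0\Leftrightarrow P(A|\theta_2)>0$. Put $\eta(x|\theta)=\int_Y\eta(xy|\theta)\frac{\sqrt{p(xy|\theta)}}{\sqrt{p(x|\theta)}}\,\nu(dy|x)$ if $p(x|\theta)>0$ and $\eta(x|\theta)=0$ otherwise. Define the scores $\tilde\eta(xy|\theta)=2\eta(xy|\theta)/\sqrt{p(xy|\theta)}$ and $\tilde\eta(x|\theta)=2\eta(x|\theta)/\sqrt{p(x|\theta)}$ (each read as $0$ where its denominator vanishes), the Fisher information matrices $$K(\theta)=4\int\eta(xy|\theta)\eta(xy|\theta)^T\,\nu(dx\,dy),\qquad I(\theta)=4\int\eta(x|\theta)\eta(x|\theta)^T\,\nu_X(dx),$$ and $J(\theta)=K(\theta)-I(\theta)$. For $x_n=(x^1,\dots,x^n)\in X^n$ and $y_n=(y^1,\dots,y^n)\in Y^n$ let $$Z_n(y_n|x_n,\theta)=n^{-1/2}\sum_{i=1}^n\tilde\eta(x^iy^i|\theta)-n^{-1/2}\sum_{i=1}^n\tilde\eta(x^i|\theta),$$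 and let $Q_n(x_n,\theta,\cdot)$ be the law of $Z_n(y_n|x_n,\theta)$ when $y_n\sim\prod_{i=1}^nP(dy^i|x^i,\theta)$. For probability measures $\mu,\mu'$ on $\mathbf R^p$ let $$w(\mu,\mu')=\sup_\psi\Bigl|\int\psi\,d\mu-\int\psi\,d\mu'\Bigr|\in[0,\infty],$$ the supremum being over all $\psi:\mathbf R^p\to\mathbf R$ with $|\psi(s)-\psi(t)|\le|s-t|$ for all $s,t$ that are integrable for $\mu$ and $\mu'$ (in particular $w$ dominates the bounded-Lipschitz distance, where moreover $|\psi|\le1$). Suppose that $K$ is continuous on $\Theta$. Then, for every $\theta\in\Theta$ at which $J(\theta)$ is non-singular, $$\lim_{n\to\infty}\int_{X^n} w\bigl(Q_n(x_n,\theta,\cdot),N(0,J(\theta))\bigr)\,\prod_{i=1}^nP(dx^i|\theta)=0.$$ -/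

import Mathlib

open MeasureTheory ProbabilityTheory Filter Topology
open scoped ENNReal

noncomputable section

namespace PartialScore

/-- `η` is a quadratic mean derivative at `θ` of the family with densities `p · x` with respect
to `ν`: `∫ |√p(x|θ+h) - √p(x|θ) - hᵀ η(x)|² ν(dx) = o(|h|²)` as `h → 0`. -/
def IsQMDeriv {S : Type*} [MeasurableSpace S] {d : ℕ} (ν : Measure S)
    (p : EuclideanSpace ℝ (Fin d) → S → ℝ) (θ : EuclideanSpace ℝ (Fin d))
    (η : S → EuclideanSpace ℝ (Fin d)) : Prop :=
  Measurable η ∧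
    ∀ ε : ℝ, 0 < ε → ∀ᶠ h in 𝓝 (0 : EuclideanSpace ℝ (Fin d)),
      ∫⁻ x, ENNReal.ofReal ((√(p (θ + h) x) - √(p θ x) - inner ℝ h (η x)) ^ 2) ∂ν
        ≤ ENNReal.ofReal (ε * ‖h‖ ^ 2)

/-- The score `2 η / √p` built from a density `p` and a quadratic mean derivative `η`. -/
def score {S : Type*} {d : ℕ} (p : S → ℝ) (η : S → EuclideanSpace ℝ (Fin d)) (x : S) :
    EuclideanSpace ℝ (Fin d) :=
  (2 / √(p x)) • η x

/-- The Fisher information matrix `4 ∫ η ηᵀ dν`. -/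
def fisherInfo {S : Type*} [MeasurableSpace S] {d : ℕ} (ν : Measure S)
    (η : S → EuclideanSpace ℝ (Fin d)) : Matrix (Fin d) (Fin d) ℝ :=
  Matrix.of fun i j => 4 * ∫ x, η x i * η x j ∂ν

/-- The normalized sum `n^{-1/2} ∑ᵢ s(xⁱ)`. -/
def normalizedSum {S : Type*} {d n : ℕ} (s : S → EuclideanSpace ℝ (Fin d)) (x : Fin n → S) :
    EuclideanSpace ℝ (Fin d) :=
  (√(n : ℝ))⁻¹ • ∑ i, s (x i)

/-- The law with density `p` with respect to `ν`. -/
def law {S : Type*} [MeasurableSpace S] (ν : Measure S) (p : S → ℝ) : Measure S :=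
  ν.withDensity fun x => ENNReal.ofReal (p x)

section Marginal

variable {X Y : Type*} [MeasurableSpace X] [MeasurableSpace Y] {d : ℕ}

/-- The marginal density `p(x) = ∫ p(x, y) κ(dy|x)`. -/
def margDensity (κ : Kernel X Y) (p : X × Y → ℝ) (x : X) : ℝ :=
  ∫ y, p (x, y) ∂(κ x)

open Classical in
/-- The marginal derivative `∫ η(x, y) √p(x, y) / √p(x) κ(dy|x)` where `p(x) > 0`,
and `0` elsewhere. -/
def margDeriv (κ : Kernel X Y) (p : X × Y → ℝ) (η : X × Y → EuclideanSpace ℝ (Fin d)) (x : X) :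
    EuclideanSpace ℝ (Fin d) :=
  if 0 < margDensity κ p x then
    ∫ y, (√(p (x, y)) / √(margDensity κ p x)) • η (x, y) ∂(κ x)
  else 0

/-- The score of the marginal model. -/
def margScore (κ : Kernel X Y) (p : X × Y → ℝ) (η : X × Y → EuclideanSpace ℝ (Fin d)) :
    X → EuclideanSpace ℝ (Fin d) :=
  score (margDensity κ p) (margDeriv κ p η)

/-- The matrix `J = K - I`: the Fisher information of the full model minus that of the
marginal model. -/
def partialInfo (ν : Measure (X × Y)) (νX : Measure X) (κ : Kernel X Y) (p : X × Y → ℝ)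
    (η : X × Y → EuclideanSpace ℝ (Fin d)) : Matrix (Fin d) (Fin d) ℝ :=
  fisherInfo ν η - fisherInfo νX (margDeriv κ p η)

/-- The normalized partial score `Zₙ(yₙ|xₙ) = Zₙ(xₙ, yₙ) - Zₙ(xₙ)`. -/
def partialZ (κ : Kernel X Y) (p : X × Y → ℝ) (η : X × Y → EuclideanSpace ℝ (Fin d)) {n : ℕ}
    (x : Fin n → X) (y : Fin n → Y) : EuclideanSpace ℝ (Fin d) :=
  normalizedSum (score p η) (fun i => (x i, y i)) - normalizedSum (margScore κ p η) x

/-- The law `Qₙ(xₙ, ·)` of `Zₙ(yₙ|xₙ)` when the `yⁱ` are independent with laws `C(dy|xⁱ)`,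
`C` being the conditional law of `y` given `x`. -/
def partialLaw (κ : Kernel X Y) (C : Kernel X Y) (p : X × Y → ℝ)
    (η : X × Y → EuclideanSpace ℝ (Fin d)) {n : ℕ} (x : Fin n → X) :
    Measure (EuclideanSpace ℝ (Fin d)) :=
  (Measure.pi fun i => C (x i)).map (partialZ κ p η x)

end Marginal

/-- `w(μ, ν) = sup |∫ ψ dμ - ∫ ψ dν|` over all functions `ψ` with Lipschitz constant `1` for which
the two integrals exist. No bound on `ψ` is imposed, so this dominates the supremum over those
`ψ` that are moreover bounded by `1`. -/
def lipDist {E : Type*} [PseudoMetricSpace E] [MeasurableSpace E] (μ ν : Measure E) : ℝ≥0∞ :=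
  ⨆ (ψ : E → ℝ) (_ : LipschitzWith 1 ψ) (_ : Integrable ψ μ) (_ : Integrable ψ ν),
    ENNReal.ofReal |∫ x, ψ x ∂μ - ∫ x, ψ x ∂ν|

end PartialScore

end

noncomputable section

namespace PartialScore

/-! Put D = S - s, with S the full score and s the marginal score. Quadratic mean differentiability
makes S square integrable under P(dx dy|θ), and s(x) is the conditional mean of S given x
(`ae_margScore_eq_integral`). So D is centred conditionally on x, and by Pythagoras its second
moment matrix is K - I = J (`integral_sub_condMean_mul`). The partial score is n^{-1/2} ∑ D(xⁱ, yⁱ),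
so what is needed is a central limit theorem conditional on the xⁱ, in mean over the xⁱ.

It is reduced to an unconditional one by drawing two copies of yₙ, independent given xₙ. The triples
(xⁱ, yⁱ, y'ⁱ) are i.i.d., and D(x, y), D(x, y') are uncorrelated because both are conditionally
centred; hence the two sums converge jointly to G ⊗ G with G = N(0, J) (`tendsto_twoCopyLaw`).
Testing against (f(z) - a)(f(z') - a) with a = ∫ f dG shows that ∫ f dQₙ - a tends to 0 in mean
square (`tendsto_lintegral_abs_sub`).

Lipschitz functions are unbounded and form an infinite family. A partition of unity on a large ball
replaces them by finitely many bounded f, with an error controlled by second moments that are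
bounded in n after averaging over xₙ (`lipDist_le`, `lintegral_secondMoment_sumLaw_le`). -/

/-- Pointwise convergence of characteristic functions in the central limit theorem, for a centred
square integrable variable of arbitrary variance. -/
lemma tendsto_charFun_pow_of_centered {Ω : Type*} [MeasurableSpace Ω] {P : Measure Ω}
    [IsProbabilityMeasure P] {V : Ω → ℝ} (hV : MemLp V 2 P) (h0 : ∫ ω, V ω ∂P = 0) :
    Tendsto (fun n : ℕ => (charFun (P.map V) ((√(n : ℝ))⁻¹)) ^ n) atTop
      (𝓝 (Complex.exp (-((∫ ω, V ω ^ 2 ∂P : ℝ) : ℂ) / 2))) := by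
  have hm : AEMeasurable V P := hV.aestronglyMeasurable.aemeasurable
  have hi : Integrable (fun ω => V ω ^ 2) P := hV.integrable_sq
  set v : ℝ := ∫ ω, V ω ^ 2 ∂P with hv
  have hv0 : 0 ≤ v := integral_nonneg fun ω => sq_nonneg _
  -- Variance zero cannot be normalized to one, but then V = 0 almost surely. Otherwise the
  -- standardized theorem is applied to V / √v at the point √v.
  rcases hv0.eq_or_lt with h | h
  · have hz : V =ᵐ[P] 0 := by
      have := (integral_eq_zero_iff_of_nonneg (fun ω => sq_nonneg (V ω)) hi).1 h.symm
      filter_upwards [this] with ω hω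
      simpa using hω
    rw [Measure.map_congr hz, ← h]
    have : P.map (0 : Ω → ℝ) = Measure.dirac 0 := by
      change P.map (fun _ => (0 : ℝ)) = _
      rw [Measure.map_const]; simp
    simp [this]
  · have hs : 0 < √v := Real.sqrt_pos.2 h
    have key := tendsto_charFun_inv_sqrt_mul_pow (P := P) (X := fun ω => (√v)⁻¹ * V ω)
      (hm.const_mul _) (by rw [integral_const_mul, h0, mul_zero])
      (by
        have : ((fun ω => (√v)⁻¹ * V ω) ^ 2) = fun ω => v⁻¹ * V ω ^ 2 := by
          ext ω
          simp [mul_pow, Real.sq_sqrt hv0]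
        rw [this, integral_const_mul, ← hv, inv_mul_cancel₀ h.ne']) (√v)
    have e : (-(((√v : ℝ) : ℂ)) ^ 2 / 2) = -(v : ℂ) / 2 := by
      rw [← Complex.ofReal_pow, Real.sq_sqrt hv0]
    rw [e] at key
    refine key.congr fun n => ?_
    rw [charFun_map_mul_comp hm]
    congr 2
    field_simp

/-! ### Conditional laws of the normalized sum and their two-copy coupling. -/

section ConditionalCLT

variable {X Y : Type*} [MeasurableSpace X] [MeasurableSpace Y] {d : ℕ}


/-- The law of `n^{-1/2} ∑ᵢ D(xⁱ, yⁱ)` when the `yⁱ` are independent with laws `C(dy|xⁱ)`. -/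
def sumLaw (C : Kernel X Y) (D : X × Y → EuclideanSpace ℝ (Fin d)) {n : ℕ} (x : Fin n → X) :
    Measure (EuclideanSpace ℝ (Fin d)) :=
  (Measure.pi fun i => C (x i)).map fun y => normalizedSum D fun i => (x i, y i)

lemma measurable_normalizedSum {D : X × Y → EuclideanSpace ℝ (Fin d)} (hD : Measurable D) {n : ℕ} :
    Measurable fun q : (Fin n → X) × (Fin n → Y) => normalizedSum D fun i => (q.1 i, q.2 i) := by
  unfold normalizedSum
  fun_prop

lemma measurable_pi_kernel (C : Kernel X Y) [IsMarkovKernel C] (n : ℕ) :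
    Measurable fun x : Fin n → X => Measure.pi fun i => C (x i) := by
  refine Measurable.measure_of_isPiSystem_of_isProbabilityMeasure generateFrom_pi.symm
    isPiSystem_pi ?_
  rintro _ ⟨s, hs, rfl⟩
  simp_rw [Measure.pi_pi]
  refine Finset.measurable_prod _ fun i _ => ?_
  exact (C.measurable_coe (hs i trivial)).comp (measurable_pi_apply i)

/-- The map applied to y depends on x too, so the law is rewritten as the image of δ_x ⊗ ∏ C(xⁱ)
under one fixed jointly measurable map. -/
lemma measurable_sumLaw (C : Kernel X Y) [IsMarkovKernel C] {D : X × Y → EuclideanSpace ℝ (Fin d)} (hD : Measurable D)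
    (n : ℕ) : Measurable fun x : Fin n → X => sumLaw C D x := by
  let K : Kernel (Fin n → X) (Fin n → Y) := ⟨_, measurable_pi_kernel C n⟩
  have : IsMarkovKernel K := ⟨fun x => by dsimp [K]; infer_instance⟩
  have h := ((Kernel.id ×ₖ K).map
    fun q : (Fin n → X) × (Fin n → Y) => normalizedSum D fun i => (q.1 i, q.2 i)).measurable
  convert! h using 2 with x
  rw [Kernel.map_apply _ (measurable_normalizedSum hD), Kernel.prod_apply, Kernel.id_apply,
    Measure.dirac_prod, Measure.map_map (measurable_normalizedSum hD) (by fun_prop)]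
  rfl

/-- Measurability of D is passed as a `Fact` so that instance search can supply the probability and
Markov properties. -/
instance isProbabilityMeasure_sumLaw (C : Kernel X Y) [IsMarkovKernel C]
    (D : X × Y → EuclideanSpace ℝ (Fin d)) [hD : Fact (Measurable D)] {n : ℕ} (x : Fin n → X) :
    IsProbabilityMeasure (sumLaw C D x) :=
  Measure.isProbabilityMeasure_map
    ((measurable_normalizedSum hD.out).comp (by fun_prop : Measurable fun y => (x, y))).aemeasurable

/-- `sumLaw` as a kernel. -/
def sumKernel (C : Kernel X Y) [IsMarkovKernel C] (D : X × Y → EuclideanSpace ℝ (Fin d))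
    [hD : Fact (Measurable D)] (n : ℕ) : Kernel (Fin n → X) (EuclideanSpace ℝ (Fin d)) :=
  ⟨fun x => sumLaw C D x, measurable_sumLaw C hD.out n⟩

instance (C : Kernel X Y) [IsMarkovKernel C] (D : X × Y → EuclideanSpace ℝ (Fin d)) [Fact (Measurable D)] (n : ℕ) :
    IsMarkovKernel (sumKernel C D n) :=
  ⟨fun x => inferInstanceAs (IsProbabilityMeasure (sumLaw C D x))⟩

lemma charFun_sumLaw (C : Kernel X Y) [IsMarkovKernel C] {D : X × Y → EuclideanSpace ℝ (Fin d)} (hD : Measurable D)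
    {n : ℕ} (x : Fin n → X) (t : EuclideanSpace ℝ (Fin d)) :
    charFun (sumLaw C D x) t =
      ∏ i, ∫ y, Complex.exp (((√(n : ℝ))⁻¹ * inner ℝ (D (x i, y)) t : ℝ) * Complex.I) ∂(C (x i)) := by
  have hm : Measurable fun y : Fin n → Y => normalizedSum D fun i => (x i, y i) :=
    (measurable_normalizedSum hD).comp (by fun_prop : Measurable fun y => (x, y))
  rw [charFun_apply, sumLaw, integral_map hm.aemeasurable (by fun_prop),
    ← integral_fintype_prod_eq_prod
      (f := fun i y => Complex.exp (((√(n : ℝ))⁻¹ * inner ℝ (D (x i, y)) t : ℝ) * Complex.I))]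
  refine integral_congr_ae (.of_forall fun y => ?_)
  dsimp only
  rw [← Complex.exp_sum, ← Finset.sum_mul, ← Complex.ofReal_sum]
  simp only [normalizedSum, real_inner_smul_left, sum_inner, Finset.mul_sum]

variable (P : Measure X) [IsProbabilityMeasure P] (C : Kernel X Y) [IsMarkovKernel C]
  (D : X × Y → EuclideanSpace ℝ (Fin d)) [Fact (Measurable D)]

/-- The joint law of two conditionally independent copies of the normalized sum, the `xⁱ` being
integrated out. -/
def twoCopyLaw (n : ℕ) :
    Measure (WithLp 2 (EuclideanSpace ℝ (Fin d) × EuclideanSpace ℝ (Fin d))) :=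
  ((Measure.pi fun _ : Fin n => P) ⊗ₘ (sumKernel C D n ×ₖ sumKernel C D n)).map
    fun q => WithLp.toLp 2 q.2

instance (n : ℕ) : IsProbabilityMeasure (twoCopyLaw P C D n) :=
  Measure.isProbabilityMeasure_map (by fun_prop)

/-- Given x, the two copies have the product law, so a function f ⊗ f integrates to the mean of a
squared conditional expectation. This is how the coupling is exploited. -/
lemma integral_twoCopyLaw {F : Type*} [NormedAddCommGroup F] [NormedSpace ℝ F] (n : ℕ)
    {f : EuclideanSpace ℝ (Fin d) × EuclideanSpace ℝ (Fin d) → F} {c : ℝ} (hc : ∀ z, ‖f z‖ ≤ c)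
    (hm : StronglyMeasurable f) :
    ∫ w, f w.ofLp ∂(twoCopyLaw P C D n) =
      ∫ x : Fin n → X, ∫ z, f z ∂((sumLaw C D x).prod (sumLaw C D x)) ∂(Measure.pi fun _ => P) := by
  rw [twoCopyLaw, integral_map (by fun_prop), Measure.integral_compProd]
  · simp_rw [Kernel.prod_apply]
    rfl
  · refine Integrable.of_bound (C := c) ?_ (.of_forall fun q => hc _)
    exact (hm.comp_measurable measurable_snd).aestronglyMeasurable
  · exact (hm.comp_measurable (by fun_prop)).aestronglyMeasurable

end ConditionalCLT
-- The central limit theorem for two copies, and its conditional consequence.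
section ConditionalCLT

variable {X Y : Type*} [MeasurableSpace X] [MeasurableSpace Y] {d : ℕ}

variable (P : Measure X) [IsProbabilityMeasure P] (C : Kernel X Y) [IsMarkovKernel C]
  (D : X × Y → EuclideanSpace ℝ (Fin d))

/-- A linear form of two conditionally independent copies of `D`. -/
def twoCopyForm (s t : EuclideanSpace ℝ (Fin d)) (q : X × (Y × Y)) : ℝ :=
  inner ℝ (D (q.1, q.2.1)) s + inner ℝ (D (q.1, q.2.2)) t

variable {D}

lemma measurable_twoCopyForm (hD : Measurable D) (s t : EuclideanSpace ℝ (Fin d)) :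
    Measurable (twoCopyForm D s t) := by
  unfold twoCopyForm
  fun_prop

lemma measurePreserving_first_copy :
    MeasurePreserving (fun q : X × (Y × Y) => (q.1, q.2.1)) (P ⊗ₘ (C ×ₖ C)) (P ⊗ₘ C) := by
  refine ⟨by fun_prop, ?_⟩
  have := Measure.compProd_map (μ := P) (κ := C ×ₖ C) (f := Prod.fst) measurable_fst
  rw [← Kernel.fst_eq, Kernel.fst_prod] at this
  rw [this]
  rfl

lemma measurePreserving_second_copy :
    MeasurePreserving (fun q : X × (Y × Y) => (q.1, q.2.2)) (P ⊗ₘ (C ×ₖ C)) (P ⊗ₘ C) := by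
  refine ⟨by fun_prop, ?_⟩
  have := Measure.compProd_map (μ := P) (κ := C ×ₖ C) (f := Prod.snd) measurable_snd
  rw [← Kernel.snd_eq, Kernel.snd_prod] at this
  rw [this]
  rfl

variable {P C}

lemma ae_integral_inner_eq_zero (hL : MemLp D 2 (P ⊗ₘ C))
    (h0 : ∀ᵐ x ∂P, ∫ y, D (x, y) ∂(C x) = 0) (t : EuclideanSpace ℝ (Fin d)) :
    ∀ᵐ x ∂P, ∫ y, inner ℝ (D (x, y)) t ∂(C x) = 0 := by
  have hi := (Measure.integrable_compProd_iff hL.aestronglyMeasurable).1 (hL.integrable one_le_two)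
  filter_upwards [h0, hi.1] with x hx hix
  simp_rw [real_inner_comm t]
  rw [integral_inner hix, hx, inner_zero_right]

lemma integral_inner_eq_zero (hL : MemLp D 2 (P ⊗ₘ C))
    (h0 : ∀ᵐ x ∂P, ∫ y, D (x, y) ∂(C x) = 0) (t : EuclideanSpace ℝ (Fin d)) :
    ∫ z, inner ℝ (D z) t ∂(P ⊗ₘ C) = 0 := by
  rw [Measure.integral_compProd ((hL.inner_const t).integrable one_le_two)]
  exact integral_eq_zero_of_ae (ae_integral_inner_eq_zero hL h0 t)

/-- Given x the copies are independent and centred, so the cross term vanishes and the variances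
add. This decouples the copies in the Gaussian limit. -/
lemma integral_twoCopyForm_sq (hL : MemLp D 2 (P ⊗ₘ C))
    (h0 : ∀ᵐ x ∂P, ∫ y, D (x, y) ∂(C x) = 0) (s t : EuclideanSpace ℝ (Fin d)) :
    MemLp (twoCopyForm D s t) 2 (P ⊗ₘ (C ×ₖ C)) ∧
    ∫ q, twoCopyForm D s t q ∂(P ⊗ₘ (C ×ₖ C)) = 0 ∧
    ∫ q, twoCopyForm D s t q ^ 2 ∂(P ⊗ₘ (C ×ₖ C)) =
      ∫ z, (inner ℝ (D z) s) ^ 2 ∂(P ⊗ₘ C) + ∫ z, (inner ℝ (D z) t) ^ 2 ∂(P ⊗ₘ C) := by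
  have hf := measurePreserving_first_copy P C
  have hg := measurePreserving_second_copy P C
  have tr : ∀ {φ : X × (Y × Y) → X × Y}, MeasurePreserving φ (P ⊗ₘ (C ×ₖ C)) (P ⊗ₘ C) →
      ∀ F : X × Y → ℝ, AEStronglyMeasurable F (P ⊗ₘ C) →
      ∫ q, F (φ q) ∂(P ⊗ₘ (C ×ₖ C)) = ∫ z, F z ∂(P ⊗ₘ C) := by
    intro φ hφ F hF
    rw [← hφ.map_eq] at hF ⊢
    exact (integral_map hφ.measurable.aemeasurable hF).symm
  have ms := hL.inner_const (𝕜 := ℝ) s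
  have mt := hL.inner_const (𝕜 := ℝ) t
  have m1 : MemLp (fun q : X × (Y × Y) => inner ℝ (D (q.1, q.2.1)) s) 2 (P ⊗ₘ (C ×ₖ C)) :=
    ms.comp_measurePreserving hf
  have m2 : MemLp (fun q : X × (Y × Y) => inner ℝ (D (q.1, q.2.2)) t) 2 (P ⊗ₘ (C ×ₖ C)) :=
    mt.comp_measurePreserving hg
  refine ⟨m1.add m2, ?_, ?_⟩
  · have := integral_add (m1.integrable one_le_two) (m2.integrable one_le_two)
    simp only [twoCopyForm]
    rw [this, tr hf (fun z => inner ℝ (D z) s) ms.aestronglyMeasurable,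
      tr hg (fun z => inner ℝ (D z) t) mt.aestronglyMeasurable,
      integral_inner_eq_zero hL h0, integral_inner_eq_zero hL h0, add_zero]
  · have hc : Integrable (fun q : X × (Y × Y) =>
        inner ℝ (D (q.1, q.2.1)) s * inner ℝ (D (q.1, q.2.2)) t) (P ⊗ₘ (C ×ₖ C)) :=
      m1.integrable_mul m2
    have hc0 : ∫ q : X × (Y × Y),
        inner ℝ (D (q.1, q.2.1)) s * inner ℝ (D (q.1, q.2.2)) t ∂(P ⊗ₘ (C ×ₖ C)) = 0 := by
      rw [Measure.integral_compProd hc]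
      refine integral_eq_zero_of_ae ?_
      filter_upwards [ae_integral_inner_eq_zero hL h0 s] with x hx
      rw [Kernel.prod_apply]
      have := integral_prod_mul (μ := C x) (ν := C x) (fun y => inner ℝ (D (x, y)) s)
        (fun y => inner ℝ (D (x, y)) t)
      simp only [Pi.zero_apply]
      rw [this, hx, zero_mul]
    have e : ∀ q, twoCopyForm D s t q ^ 2 = (inner ℝ (D (q.1, q.2.1)) s) ^ 2 +
        (inner ℝ (D (q.1, q.2.2)) t) ^ 2 +
        2 * (inner ℝ (D (q.1, q.2.1)) s * inner ℝ (D (q.1, q.2.2)) t) := by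
      intro q
      simp only [twoCopyForm]
      ring
    simp_rw [e]
    have i12 : Integrable (fun q : X × (Y × Y) => (inner ℝ (D (q.1, q.2.1)) s) ^ 2 +
        (inner ℝ (D (q.1, q.2.2)) t) ^ 2) (P ⊗ₘ (C ×ₖ C)) :=
      m1.integrable_sq.add m2.integrable_sq
    rw [integral_add i12 (hc.const_mul 2),
      integral_add m1.integrable_sq m2.integrable_sq, integral_const_mul, hc0,
      tr hf (fun z => (inner ℝ (D z) s) ^ 2) (ms.aestronglyMeasurable.pow 2),
      tr hg (fun z => (inner ℝ (D z) t) ^ 2) (mt.aestronglyMeasurable.pow 2)]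
    ring

/-- The triples (xⁱ, yⁱ, y'ⁱ) are i.i.d., so the characteristic function is an n-th power of a
one-dimensional one, to which the classical theorem applies. -/
lemma charFun_twoCopyLaw [hD : Fact (Measurable D)] (n : ℕ)
    (t : WithLp 2 (EuclideanSpace ℝ (Fin d) × EuclideanSpace ℝ (Fin d))) :
    charFun (twoCopyLaw P C D n) t =
      (charFun ((P ⊗ₘ (C ×ₖ C)).map (twoCopyForm D t.ofLp.1 t.ofLp.2)) ((√(n : ℝ))⁻¹)) ^ n := by
  have hm := measurable_twoCopyForm hD.out t.ofLp.1 t.ofLp.2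
  have step : charFun (twoCopyLaw P C D n) t = ∫ x : Fin n → X,
      charFun (((sumLaw C D x).prod (sumLaw C D x)).map (WithLp.toLp 2)) t
        ∂(Measure.pi fun _ => P) := by
    have h := integral_twoCopyLaw P C D n
      (f := fun z => Complex.exp (inner ℝ (WithLp.toLp 2 z) t * Complex.I)) (c := 1)
      (fun z => by rw [Complex.norm_exp_ofReal_mul_I])
      (Continuous.stronglyMeasurable (by fun_prop))
    rw [charFun_apply]
    refine Eq.trans h ?_
    refine integral_congr_ae (.of_forall fun x => ?_)
    dsimp only
    rw [charFun_apply, integral_map (by fun_prop) (by fun_prop)]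
  rw [step]
  simp_rw [charFun_prod, charFun_sumLaw C hD.out, ← Finset.prod_mul_distrib]
  rw [integral_fintype_prod_eq_prod (f := fun (_ : Fin n) (x : X) =>
    (∫ y, Complex.exp (((√(n : ℝ))⁻¹ * inner ℝ (D (x, y)) t.ofLp.1 : ℝ) * Complex.I) ∂(C x)) *
    ∫ y, Complex.exp (((√(n : ℝ))⁻¹ * inner ℝ (D (x, y)) t.ofLp.2 : ℝ) * Complex.I) ∂(C x)),
    Finset.prod_const, Finset.card_univ, Fintype.card_fin]
  congr 1
  rw [charFun_apply, integral_map hm.aemeasurable (by fun_prop), Measure.integral_compProd]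
  · refine integral_congr_ae (.of_forall fun x => ?_)
    dsimp only
    rw [Kernel.prod_apply, ← integral_prod_mul]
    refine integral_congr_ae (.of_forall fun y => ?_)
    dsimp only
    rw [← Complex.exp_add, ← add_mul, ← Complex.ofReal_add, ← mul_add]
    simp [twoCopyForm]
  · refine Integrable.of_bound (C := 1) (by fun_prop) (.of_forall fun q => ?_)
    rw [Complex.norm_exp_ofReal_mul_I]

/-- Weak convergence of the law of two conditionally independent copies of the normalized sum
to two independent copies of the limit. -/
lemma tendsto_twoCopyLaw [hD : Fact (Measurable D)] (hL : MemLp D 2 (P ⊗ₘ C))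
    (h0 : ∀ᵐ x ∂P, ∫ y, D (x, y) ∂(C x) = 0)
    (G : Measure (EuclideanSpace ℝ (Fin d))) [IsProbabilityMeasure G]
    (hG : ∀ t, charFun G t = Complex.exp (-((∫ z, (inner ℝ (D z) t) ^ 2 ∂(P ⊗ₘ C) : ℝ) : ℂ) / 2))
    {f : EuclideanSpace ℝ (Fin d) × EuclideanSpace ℝ (Fin d) → ℝ} (hf : Continuous f) {c : ℝ}
    (hc : ∀ z, ‖f z‖ ≤ c) :
    Tendsto (fun n => ∫ w, f w.ofLp ∂(twoCopyLaw P C D n)) atTop (𝓝 (∫ z, f z ∂(G.prod G))) := by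
  have hGp : IsProbabilityMeasure ((G.prod G).map (WithLp.toLp 2)) :=
    Measure.isProbabilityMeasure_map (by fun_prop)
  let M : ℕ → ProbabilityMeasure
      (WithLp 2 (EuclideanSpace ℝ (Fin d) × EuclideanSpace ℝ (Fin d))) :=
    fun n => ⟨twoCopyLaw P C D n, inferInstance⟩
  let M₀ : ProbabilityMeasure
      (WithLp 2 (EuclideanSpace ℝ (Fin d) × EuclideanSpace ℝ (Fin d))) :=
    ⟨(G.prod G).map (WithLp.toLp 2), hGp⟩
  have hM : ∀ n, (M n : Measure (WithLp 2 (EuclideanSpace ℝ (Fin d) × EuclideanSpace ℝ (Fin d)))) =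
    twoCopyLaw P C D n := fun n => rfl
  have hM₀ : (M₀ : Measure (WithLp 2 (EuclideanSpace ℝ (Fin d) × EuclideanSpace ℝ (Fin d)))) =
    (G.prod G).map (WithLp.toLp 2) := rfl
  have h : Tendsto M atTop (𝓝 M₀) := by
    -- Lévy's continuity theorem, on the L² product, which carries an inner product.
    refine ProbabilityMeasure.tendsto_of_tendsto_charFun fun t => ?_
    obtain ⟨hm, h1, h2⟩ := integral_twoCopyForm_sq hL h0 t.ofLp.1 t.ofLp.2
    have key := tendsto_charFun_pow_of_centered hm h1
    simp only [hM, hM₀, charFun_twoCopyLaw, charFun_prod, hG]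
    rw [← Complex.exp_add]
    convert key using 3
    rw [h2]
    push_cast
    ring
  rw [ProbabilityMeasure.tendsto_iff_forall_integral_tendsto] at h
  have := h (BoundedContinuousFunction.ofNormedAddCommGroup
    (fun w : WithLp 2 (EuclideanSpace ℝ (Fin d) × EuclideanSpace ℝ (Fin d)) => f w.ofLp)
    (by fun_prop) c fun w => hc _)
  convert! this using 2
  simp only [hM₀, BoundedContinuousFunction.coe_ofNormedAddCommGroup]
  rw [integral_map (by fun_prop) (by fun_prop)]

/-- Conditional central limit theorem, tested against a bounded continuous function. -/
lemma tendsto_lintegral_abs_sub [hD : Fact (Measurable D)] (hL : MemLp D 2 (P ⊗ₘ C))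
    (h0 : ∀ᵐ x ∂P, ∫ y, D (x, y) ∂(C x) = 0)
    (G : Measure (EuclideanSpace ℝ (Fin d))) [IsProbabilityMeasure G]
    (hG : ∀ t, charFun G t = Complex.exp (-((∫ z, (inner ℝ (D z) t) ^ 2 ∂(P ⊗ₘ C) : ℝ) : ℂ) / 2))
    {f : EuclideanSpace ℝ (Fin d) → ℝ} (hf : Continuous f) {c : ℝ} (hc : ∀ z, ‖f z‖ ≤ c) :
    Tendsto (fun n : ℕ => ∫⁻ x : Fin n → X,
      ENNReal.ofReal |∫ z, f z ∂(sumLaw C D x) - ∫ z, f z ∂G| ∂(Measure.pi fun _ => P))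
      atTop (𝓝 0) := by
  have hfi : ∀ (μ : Measure (EuclideanSpace ℝ (Fin d))) [IsProbabilityMeasure μ],
      Integrable f μ := fun μ _ =>
    Integrable.of_bound hf.aestronglyMeasurable c (.of_forall hc)
  set a : ℝ := ∫ z, f z ∂G with ha
  have hab : ∀ z, ‖f z - a‖ ≤ c + |a| := fun z => (norm_sub_le _ _).trans (by
    gcongr
    · exact hc z
    · rfl)
  -- Under μ ⊗ μ the centred product integrates to a square, which is zero for μ = G by the choice
  -- of a.
  have hint : ∀ (μ : Measure (EuclideanSpace ℝ (Fin d))) [IsProbabilityMeasure μ],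
      ∫ z, (f z.1 - a) * (f z.2 - a) ∂(μ.prod μ) = (∫ z, f z ∂μ - a) ^ 2 := by
    intro μ _
    rw [integral_prod_mul (fun z => f z - a) (fun z => f z - a),
      integral_sub (hfi μ) (integrable_const a)]
    simp [sq]
  have hb : ∀ z : EuclideanSpace ℝ (Fin d) × EuclideanSpace ℝ (Fin d),
      ‖(f z.1 - a) * (f z.2 - a)‖ ≤ (c + |a|) * (c + |a|) := fun z => by
    rw [norm_mul]
    exact mul_le_mul (hab _) (hab _) (norm_nonneg _) ((norm_nonneg _).trans (hab z.1))
  have hcont : Continuous fun z : EuclideanSpace ℝ (Fin d) × EuclideanSpace ℝ (Fin d) =>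
      (f z.1 - a) * (f z.2 - a) := by fun_prop
  have key := tendsto_twoCopyLaw hL h0 G hG hcont hb
  rw [hint G, ← ha, sub_self, zero_pow two_ne_zero] at key
  have key2 : Tendsto (fun n : ℕ => ENNReal.ofReal (√(∫ x : Fin n → X,
      (∫ z, f z ∂(sumLaw C D x) - a) ^ 2 ∂(Measure.pi fun _ => P)))) atTop (𝓝 0) := by
    have h1 := (ENNReal.continuous_ofReal.comp Real.continuous_sqrt).tendsto 0 |>.comp key
    simp only [Function.comp_def, Real.sqrt_zero, ENNReal.ofReal_zero] at h1
    refine h1.congr fun n => ?_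
    rw [integral_twoCopyLaw P C D n hb hcont.stronglyMeasurable]
    simp_rw [hint]
  refine tendsto_of_tendsto_of_tendsto_of_le_of_le tendsto_const_nhds key2 (fun _ => zero_le)
    fun n => ?_
  dsimp only
  have hsm : StronglyMeasurable fun x : Fin n → X => ∫ z, f z ∂(sumLaw C D x) - a :=
    (StronglyMeasurable.integral_kernel (κ := sumKernel C D n) hf.stronglyMeasurable).sub
      stronglyMeasurable_const
  have hbd : ∀ x : Fin n → X, ‖∫ z, f z ∂(sumLaw C D x) - a‖ ≤ c + |a| := fun x => by
    refine (norm_sub_le _ _).trans (add_le_add ?_ le_rfl)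
    simpa using norm_integral_le_of_norm_le_const (μ := sumLaw C D x) (.of_forall hc)
  have hL2 : MemLp (fun x : Fin n → X => |∫ z, f z ∂(sumLaw C D x) - a|) 2
      (Measure.pi fun _ => P) :=
    (MemLp.of_bound hsm.aestronglyMeasurable _ (.of_forall hbd)).abs
  rw [← ofReal_integral_eq_lintegral_ofReal (hL2.integrable one_le_two)
    (.of_forall fun x => abs_nonneg _)]
  refine ENNReal.ofReal_le_ofReal (Real.le_sqrt_of_sq_le ?_)
  -- Jensen's inequality, as nonnegativity of a variance: the mean is at most the root mean square.
  have hv := variance_nonneg (fun x : Fin n → X => |∫ z, f z ∂(sumLaw C D x) - a|)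
    (Measure.pi fun _ => P)
  rw [variance_eq_sub hL2] at hv
  simpa [sq_abs] using hv

end ConditionalCLT
-- Reduction of the Lipschitz distance to finitely many test functions.
section LipDist

variable {d : ℕ}

/-- The family depends on R and ε only, so it serves all 1-Lipschitz ψ at once. -/
lemma exists_partitionOfUnity_closedBall (R ε : ℝ) (hε : 0 < ε) :
    ∃ (t : Finset (EuclideanSpace ℝ (Fin d))) (f : t → C(EuclideanSpace ℝ (Fin d), ℝ)),
      (∀ c : t, ‖(c : EuclideanSpace ℝ (Fin d))‖ ≤ R) ∧ (∀ c z, 0 ≤ f c z) ∧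
      (∀ z, ∑ c, f c z ≤ 1) ∧ (∀ z, ‖z‖ ≤ R → ∑ c, f c z = 1) ∧
      ∀ (c : t) z, f c z ≠ 0 → ‖z - c‖ < ε := by
  obtain ⟨t, ht, htf, hcov⟩ :=
    (isCompact_closedBall (0 : EuclideanSpace ℝ (Fin d)) R).finite_cover_balls hε
  lift t to Finset (EuclideanSpace ℝ (Fin d)) using htf
  obtain ⟨f, hf⟩ := PartitionOfUnity.exists_isSubordinate
    (Metric.isClosed_closedBall (x := (0 : EuclideanSpace ℝ (Fin d))) (ε := R))
    (fun c : t => Metric.ball (c : EuclideanSpace ℝ (Fin d)) ε) (fun _ => Metric.isOpen_ball)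
    (by simpa [Set.iUnion_subtype] using hcov)
  refine ⟨t, fun c => f c, fun c => by simpa using ht c.2, fun c z => f.nonneg c z, fun z => ?_,
    fun z hz => ?_, fun c z h => ?_⟩
  · simpa [finsum_eq_sum_of_fintype] using f.sum_le_one z
  · simpa [finsum_eq_sum_of_fintype] using f.sum_eq_one (x := z) (by simpa using hz)
  · have := hf c (subset_tsupport _ h)
    simpa [dist_eq_norm] using this

/-- Inside the ball ψ is averaged over its values at centres within ε. Outside, the uncovered mass
costs at most |ψ(z) - ψ(0)| ≤ ‖z‖ ≤ ‖z‖² / R. -/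
lemma abs_sub_sum_le {R ε : ℝ} (hR : 0 < R) {t : Finset (EuclideanSpace ℝ (Fin d))}
    {f : t → C(EuclideanSpace ℝ (Fin d), ℝ)} (h0 : ∀ c z, 0 ≤ f c z)
    (h1 : ∀ z, ∑ c, f c z ≤ 1) (hs : ∀ z, ‖z‖ ≤ R → ∑ c, f c z = 1)
    (hd : ∀ (c : t) z, f c z ≠ 0 → ‖z - c‖ < ε) (hε : 0 < ε)
    {ψ : EuclideanSpace ℝ (Fin d) → ℝ} (hψ : LipschitzWith 1 ψ) (z : EuclideanSpace ℝ (Fin d)) :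
    |ψ z - (ψ 0 + ∑ c : t, (ψ c - ψ 0) * f c z)| ≤ ε + ‖z‖ ^ 2 / R := by
  have hl : ∀ a b, |ψ a - ψ b| ≤ ‖a - b‖ := fun a b => by
    simpa [Real.dist_eq, dist_eq_norm] using hψ.dist_le_mul a b
  have e : ψ z - (ψ 0 + ∑ c : t, (ψ c - ψ 0) * f c z) =
      ∑ c : t, (ψ z - ψ c) * f c z + (1 - ∑ c, f c z) * (ψ z - ψ 0) := by
    have : ∀ c : t, (ψ z - ψ c) * f c z = (ψ z - ψ 0) * f c z - (ψ c - ψ 0) * f c z :=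
      fun c => by ring
    simp_rw [this, Finset.sum_sub_distrib, ← Finset.mul_sum]
    ring
  rw [e]
  refine (abs_add_le _ _).trans (add_le_add ?_ ?_)
  · calc |∑ c : t, (ψ z - ψ c) * f c z| ≤ ∑ c : t, |(ψ z - ψ c) * f c z| :=
          Finset.abs_sum_le_sum_abs _ _
      _ ≤ ∑ c : t, ε * f c z := by
          refine Finset.sum_le_sum fun c _ => ?_
          rw [abs_mul, abs_of_nonneg (h0 c z)]
          by_cases hc : f c z = 0
          · simp [hc]
          · exact mul_le_mul_of_nonneg_right ((hl _ _).trans (hd c z hc).le) (h0 c z)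
      _ = ε * ∑ c : t, f c z := by rw [Finset.mul_sum]
      _ ≤ ε := mul_le_of_le_one_right hε.le (h1 z)
  · by_cases hz : ‖z‖ ≤ R
    · rw [hs z hz, sub_self, zero_mul, abs_zero]
      positivity
    · push Not at hz
      have hnn : 0 ≤ ∑ c, f c z := Finset.sum_nonneg fun c _ => h0 c z
      rw [abs_mul, abs_of_nonneg (sub_nonneg.2 (h1 z))]
      calc (1 - ∑ c, f c z) * |ψ z - ψ 0| ≤ 1 * ‖z‖ := by
            refine mul_le_mul (by linarith) ?_ (abs_nonneg _) zero_le_one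
            simpa using hl z 0
        _ ≤ ‖z‖ ^ 2 / R := by
            rw [le_div_iff₀ hR]
            nlinarith [norm_nonneg z]

/-- The second moment. -/
def secondMoment (μ : Measure (EuclideanSpace ℝ (Fin d))) : ℝ≥0∞ :=
  ∫⁻ z, ENNReal.ofReal (‖z‖ ^ 2) ∂μ

/-- The Lipschitz distance is controlled by second moments and the discrepancies along finitely
many bounded continuous functions. -/
lemma lipDist_le {R ε : ℝ} (hR : 0 < R) {t : Finset (EuclideanSpace ℝ (Fin d))}
    {f : t → C(EuclideanSpace ℝ (Fin d), ℝ)}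
    (hc : ∀ c : t, ‖(c : EuclideanSpace ℝ (Fin d))‖ ≤ R) (h0 : ∀ c z, 0 ≤ f c z)
    (h1 : ∀ z, ∑ c, f c z ≤ 1) (hs : ∀ z, ‖z‖ ≤ R → ∑ c, f c z = 1)
    (hd : ∀ (c : t) z, f c z ≠ 0 → ‖z - c‖ < ε) (hε : 0 < ε)
    (μ G : Measure (EuclideanSpace ℝ (Fin d))) [IsProbabilityMeasure μ] [IsProbabilityMeasure G] :
    lipDist μ G ≤ (ENNReal.ofReal ε + secondMoment μ / ENNReal.ofReal R) +
      (ENNReal.ofReal ε + secondMoment G / ENNReal.ofReal R) +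
      ENNReal.ofReal R * ∑ c : t, ENNReal.ofReal |∫ z, f c z ∂μ - ∫ z, f c z ∂G| := by
  refine iSup_le fun ψ => iSup_le fun hψ => iSup_le fun hμ => iSup_le fun hG => ?_
  have hfi : ∀ (m : Measure (EuclideanSpace ℝ (Fin d))) [IsProbabilityMeasure m] (c : t),
      Integrable (f c) m := fun m _ c => by
    refine Integrable.of_bound (f c).continuous.aestronglyMeasurable 1 (.of_forall fun z => ?_)
    rw [Real.norm_of_nonneg (h0 c z)]
    exact (Finset.single_le_sum (fun c _ => h0 c z) (Finset.mem_univ c)).trans (h1 z)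
  have hb : ∀ (m : Measure (EuclideanSpace ℝ (Fin d))) [IsProbabilityMeasure m],
      Integrable ψ m →
      ENNReal.ofReal |∫ z, ψ z ∂m - (ψ 0 + ∑ c : t, (ψ c - ψ 0) * ∫ z, f c z ∂m)| ≤
        ENNReal.ofReal ε + secondMoment m / ENNReal.ofReal R := by
    intro m _ hm
    have hsum : Integrable (fun z => ∑ c : t, (ψ c - ψ 0) * f c z) m :=
      integrable_finsetSum _ fun c _ => (hfi m c).const_mul _
    have e : ∫ z, ψ z ∂m - (ψ 0 + ∑ c : t, (ψ c - ψ 0) * ∫ z, f c z ∂m) =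
        ∫ z, (ψ z - (ψ 0 + ∑ c : t, (ψ c - ψ 0) * f c z)) ∂m := by
      have hadd : Integrable (fun z => ψ 0 + ∑ c : t, (ψ c - ψ 0) * f c z) m :=
        (integrable_const _).add hsum
      rw [integral_sub hm hadd, integral_add (integrable_const _) hsum,
        integral_finsetSum _ fun c _ => (hfi m c).const_mul _]
      simp [integral_const_mul]
    rw [e, ← Real.norm_eq_abs, ofReal_norm]
    refine (enorm_integral_le_lintegral_enorm _).trans ?_
    calc ∫⁻ z, ‖ψ z - (ψ 0 + ∑ c : t, (ψ c - ψ 0) * f c z)‖ₑ ∂m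
        ≤ ∫⁻ z, (ENNReal.ofReal ε + ENNReal.ofReal (‖z‖ ^ 2) / ENNReal.ofReal R) ∂m := by
          refine lintegral_mono fun z => ?_
          rw [← ofReal_norm, Real.norm_eq_abs, ← ENNReal.ofReal_div_of_pos hR,
            ← ENNReal.ofReal_add hε.le (by positivity)]
          exact ENNReal.ofReal_le_ofReal (abs_sub_sum_le hR h0 h1 hs hd hε hψ z)
      _ = ENNReal.ofReal ε + secondMoment m / ENNReal.ofReal R := by
          rw [lintegral_add_left measurable_const]
          simp only [lintegral_const, measure_univ, mul_one, secondMoment, div_eq_mul_inv]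
          rw [lintegral_mul_const _ (by fun_prop)]
  -- The factor R bounds |ψ(c) - ψ(0)| ≤ ‖c‖, which removes ψ from the estimate.
  have hdiff : |∑ c : t, (ψ c - ψ 0) * ∫ z, f c z ∂μ - ∑ c : t, (ψ c - ψ 0) * ∫ z, f c z ∂G| ≤
      R * ∑ c : t, |∫ z, f c z ∂μ - ∫ z, f c z ∂G| := by
    rw [← Finset.sum_sub_distrib, Finset.mul_sum]
    refine (Finset.abs_sum_le_sum_abs _ _).trans (Finset.sum_le_sum fun c _ => ?_)
    rw [← mul_sub, abs_mul]
    refine mul_le_mul_of_nonneg_right ?_ (abs_nonneg _)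
    have := hψ.dist_le_mul c 0
    rw [Real.dist_eq, dist_eq_norm] at this
    simpa using this.trans (by simpa using hc c)
  set A := ∑ c : t, (ψ c - ψ 0) * ∫ z, f c z ∂μ
  set B := ∑ c : t, (ψ c - ψ 0) * ∫ z, f c z ∂G
  have tri : |∫ z, ψ z ∂μ - ∫ z, ψ z ∂G| ≤ |∫ z, ψ z ∂μ - (ψ 0 + A)| +
      |∫ z, ψ z ∂G - (ψ 0 + B)| + R * ∑ c : t, |∫ z, f c z ∂μ - ∫ z, f c z ∂G| := by
    have h2 := abs_sub_comm (∫ z, ψ z ∂G) (ψ 0 + B)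
    have h3 : ∫ z, ψ z ∂μ - ∫ z, ψ z ∂G = (∫ z, ψ z ∂μ - (ψ 0 + A)) +
      ((ψ 0 + B) - ∫ z, ψ z ∂G) + (A - B) := by ring
    rw [h3, h2]
    exact (abs_add_three _ _ _).trans (by gcongr)
  refine (ENNReal.ofReal_le_ofReal tri).trans ?_
  rw [ENNReal.ofReal_add (by positivity) (by positivity),
    ENNReal.ofReal_add (abs_nonneg _) (abs_nonneg _), ENNReal.ofReal_mul hR.le,
    ENNReal.ofReal_sum_of_nonneg fun c _ => abs_nonneg _]
  gcongr
  · exact hb μ hμ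
  · exact hb G hG

end LipDist

/-! ### Second moments of the sums, and convergence in the Lipschitz distance. -/

section SecondMoment

variable {d : ℕ}

/-- Orthogonality of independent centred variables, coordinate by coordinate. -/
lemma lintegral_norm_sum_sq_pi {ι : Type*} [Fintype ι] {Y : Type*} [MeasurableSpace Y]
    {μ : ι → Measure Y} [∀ i, IsProbabilityMeasure (μ i)]
    {V : ι → Y → EuclideanSpace ℝ (Fin d)} (hV : ∀ i, MemLp (V i) 2 (μ i))
    (h0 : ∀ i, ∫ y, V i y ∂(μ i) = 0) :
    ∫⁻ y, ENNReal.ofReal (‖∑ i, V i (y i)‖ ^ 2) ∂(Measure.pi μ) =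
      ∑ i, ∫⁻ y, ENNReal.ofReal (‖V i y‖ ^ 2) ∂(μ i) := by
  have hk : ∀ i (k : Fin d), MemLp (fun y => V i y k) 2 (μ i) := fun i k =>
    (EuclideanSpace.proj (𝕜 := ℝ) k).comp_memLp' (hV i)
  have hk0 : ∀ i (k : Fin d), ∫ y, V i y k ∂(μ i) = 0 := fun i k => by
    have := (EuclideanSpace.proj (𝕜 := ℝ) k).integral_comp_comm ((hV i).integrable one_le_two)
    simpa [h0] using this
  have hp : ∀ i (k : Fin d), MemLp (fun y : ι → Y => V i (y i) k) 2 (Measure.pi μ) :=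
    fun i k => (hk i k).comp_measurePreserving (measurePreserving_eval μ i)
  have hps : ∀ k : Fin d, MemLp (fun y : ι → Y => ∑ i, V i (y i) k) 2 (Measure.pi μ) :=
    fun k => memLp_finsetSum _ fun i _ => hp i k
  have hsq : ∀ k : Fin d, ∫ y : ι → Y, (∑ i, V i (y i) k) ^ 2 ∂(Measure.pi μ) =
      ∑ i, ∫ y, V i y k ^ 2 ∂(μ i) := by
    intro k
    have h := variance_sum_pi (μ := μ) (X := fun i y => V i y k) fun i => hk i k
    have e : (∑ i, fun y : ι → Y => V i (y i) k) = fun y => ∑ i, V i (y i) k := by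
      ext y; simp
    have m0 : ∫ y : ι → Y, ∑ i, V i (y i) k ∂(Measure.pi μ) = 0 := by
      rw [integral_finsetSum _ fun i _ => (hp i k).integrable one_le_two]
      refine Finset.sum_eq_zero fun i _ => ?_
      have := integral_comp_eval (μ := μ) (i := i) (f := fun y => V i y k)
        (hk i k).aestronglyMeasurable
      rw [this, hk0]
    rw [e, variance_of_integral_eq_zero (hps k).aestronglyMeasurable.aemeasurable m0] at h
    rw [h]
    exact Finset.sum_congr rfl fun i _ =>
      variance_of_integral_eq_zero (hk i k).aestronglyMeasurable.aemeasurable (hk0 i k)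
  have hn : ∀ v : EuclideanSpace ℝ (Fin d),
      ENNReal.ofReal (‖v‖ ^ 2) = ∑ k, ENNReal.ofReal (v k ^ 2) := fun v => by
    rw [EuclideanSpace.real_norm_sq_eq, ENNReal.ofReal_sum_of_nonneg fun k _ => sq_nonneg _]
  simp_rw [hn]
  rw [lintegral_finsetSum' _ fun k _ => ?_]
  · rw [Finset.sum_congr rfl fun i _ => lintegral_finsetSum' _ fun k _ =>
      ((hk i k).aestronglyMeasurable.aemeasurable.pow_const 2).ennreal_ofReal, Finset.sum_comm]
    refine Finset.sum_congr rfl fun k _ => ?_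
    simp_rw [WithLp.ofLp_sum, Finset.sum_apply]
    rw [← ofReal_integral_eq_lintegral_ofReal (hps k).integrable_sq
      (.of_forall fun y => sq_nonneg _), hsq, ENNReal.ofReal_sum_of_nonneg fun i _ =>
        integral_nonneg fun y => sq_nonneg _]
    exact Finset.sum_congr rfl fun i _ => ofReal_integral_eq_lintegral_ofReal
      (hk i k).integrable_sq (.of_forall fun y => sq_nonneg _)
  · simp_rw [WithLp.ofLp_sum, Finset.sum_apply]
    exact ((hps k).aestronglyMeasurable.aemeasurable.pow_const 2).ennreal_ofReal

variable {X Y : Type*} [MeasurableSpace X] [MeasurableSpace Y]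
  {P : Measure X} [IsProbabilityMeasure P] {C : Kernel X Y} [IsMarkovKernel C]
  {D : X × Y → EuclideanSpace ℝ (Fin d)}

lemma lintegral_secondMoment_sumLaw_le (hD : Measurable D) (hL : MemLp D 2 (P ⊗ₘ C))
    (h0 : ∀ᵐ x ∂P, ∫ y, D (x, y) ∂(C x) = 0) (n : ℕ) :
    ∫⁻ x : Fin n → X, secondMoment (sumLaw C D x) ∂(Measure.pi fun _ => P) ≤
      ∫⁻ z, ENNReal.ofReal (‖D z‖ ^ 2) ∂(P ⊗ₘ C) := by
  have hmem : ∀ᵐ x ∂P, MemLp (fun y => D (x, y)) 2 (C x) := by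
    have hi := (Measure.integrable_compProd_iff (hL.norm.integrable_sq).aestronglyMeasurable).1
      hL.norm.integrable_sq
    filter_upwards [hi.1] with x hx
    exact (memLp_two_iff_integrable_sq_norm
      (hD.comp measurable_prodMk_left).aestronglyMeasurable).2 hx
  have hae : ∀ᵐ x : Fin n → X ∂(Measure.pi fun _ => P), ∀ i,
      MemLp (fun y => D (x i, y)) 2 (C (x i)) ∧ ∫ y, D (x i, y) ∂(C (x i)) = 0 :=
    ae_all_iff.2 fun i => (measurePreserving_eval (fun _ : Fin n => P) i).quasiMeasurePreserving.ae
      (hmem.and h0)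
  have hmeas : Measurable fun x => ∫⁻ y, ENNReal.ofReal (‖D (x, y)‖ ^ 2) ∂(C x) :=
    Measurable.lintegral_kernel_prod_right' (f := fun z => ENNReal.ofReal (‖D z‖ ^ 2))
      (by fun_prop)
  have hx : ∀ᵐ x : Fin n → X ∂(Measure.pi fun _ => P), secondMoment (sumLaw C D x) =
      ENNReal.ofReal ((n : ℝ)⁻¹) *
        ∑ i, ∫⁻ y, ENNReal.ofReal (‖D (x i, y)‖ ^ 2) ∂(C (x i)) := by
    filter_upwards [hae] with x hx
    have hm : Measurable fun y : Fin n → Y => normalizedSum D fun i => (x i, y i) :=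
      (measurable_normalizedSum hD).comp (by fun_prop : Measurable fun y => (x, y))
    rw [secondMoment, sumLaw, lintegral_map (by fun_prop) hm,
      ← lintegral_norm_sum_sq_pi (fun i => (hx i).1) (fun i => (hx i).2),
      ← lintegral_const_mul _ (by fun_prop)]
    refine lintegral_congr fun y => ?_
    rw [← ENNReal.ofReal_mul (by positivity), normalizedSum, norm_smul, mul_pow, norm_inv,
      Real.norm_of_nonneg (Real.sqrt_nonneg _), inv_pow, Real.sq_sqrt (Nat.cast_nonneg n)]
  have hmi : ∀ i : Fin n, Measurable fun x : Fin n → X =>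
      ∫⁻ y, ENNReal.ofReal (‖D (x i, y)‖ ^ 2) ∂(C (x i)) :=
    fun i => hmeas.comp (measurable_pi_apply i)
  rw [lintegral_congr_ae hx, lintegral_const_mul _ (Finset.measurable_sum _ fun i _ => hmi i),
    lintegral_finsetSum _ fun i _ => hmi i]
  have hev : ∀ i : Fin n, ∫⁻ x : Fin n → X, ∫⁻ y, ENNReal.ofReal (‖D (x i, y)‖ ^ 2) ∂(C (x i))
      ∂(Measure.pi fun _ => P) = ∫⁻ z, ENNReal.ofReal (‖D z‖ ^ 2) ∂(P ⊗ₘ C) := fun i => by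
    rw [Measure.lintegral_compProd (by fun_prop)]
    exact (measurePreserving_eval (fun _ : Fin n => P) i).lintegral_comp hmeas
  simp_rw [hev]
  rw [Finset.sum_const, Finset.card_univ, Fintype.card_fin, nsmul_eq_mul, ← mul_assoc]
  -- The factor n⁻¹ · n is 1 for n > 0 and 0 for n = 0, hence an inequality.
  refine mul_le_of_le_one_left zero_le ?_
  rw [← ENNReal.ofReal_natCast, ← ENNReal.ofReal_mul (by positivity)]
  exact ENNReal.ofReal_le_one.2 (inv_mul_le_one)

/-- Conditional central limit theorem in the Lipschitz distance. -/
theorem tendsto_lintegral_lipDist_sumLaw (hD : Measurable D) (hL : MemLp D 2 (P ⊗ₘ C))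
    (h0 : ∀ᵐ x ∂P, ∫ y, D (x, y) ∂(C x) = 0)
    (G : Measure (EuclideanSpace ℝ (Fin d))) [IsProbabilityMeasure G]
    (hG : ∀ t, charFun G t = Complex.exp (-((∫ z, (inner ℝ (D z) t) ^ 2 ∂(P ⊗ₘ C) : ℝ) : ℂ) / 2))
    (hG2 : secondMoment G ≠ ∞) :
    Tendsto (fun n : ℕ => ∫⁻ x : Fin n → X, lipDist (sumLaw C D x) G ∂(Measure.pi fun _ => P))
      atTop (𝓝 0) := by
  have : Fact (Measurable D) := ⟨hD⟩
  set m := ∫⁻ z, ENNReal.ofReal (‖D z‖ ^ 2) ∂(P ⊗ₘ C)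
  have hm : m ≠ ∞ := (hL.norm.integrable_sq).lintegral_lt_top.ne
  -- the part of the bound that does not depend on `n`
  have hsmall : Tendsto (fun r : ℝ => (ENNReal.ofReal r⁻¹ + m / ENNReal.ofReal r) +
      (ENNReal.ofReal r⁻¹ + secondMoment G / ENNReal.ofReal r)) atTop (𝓝 0) := by
    have h1 : Tendsto (fun r : ℝ => ENNReal.ofReal r⁻¹) atTop (𝓝 0) := by
      simpa [Function.comp_def] using (ENNReal.continuous_ofReal.tendsto 0).comp tendsto_inv_atTop_zero
    have h2 : ∀ a : ℝ≥0∞, a ≠ ∞ → Tendsto (fun r : ℝ => a / ENNReal.ofReal r) atTop (𝓝 0) :=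
      fun a ha => by
        simpa using ENNReal.Tendsto.const_div ENNReal.tendsto_ofReal_atTop (Or.inr ha)
    simpa using (h1.add (h2 m hm)).add (h1.add (h2 _ hG2))
  refine ENNReal.tendsto_nhds_zero.2 fun δ hδ => ?_
  have hδ2 : 0 < δ / 2 := ENNReal.half_pos hδ.ne'
  -- R is fixed before n. The mesh is taken to be R⁻¹, so a single parameter controls both errors.
  obtain ⟨R, hRδ, hR⟩ := ((ENNReal.tendsto_nhds_zero.1 hsmall _ hδ2).and
    (eventually_gt_atTop 0)).exists
  have hRi : 0 < R⁻¹ := inv_pos.2 hR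
  obtain ⟨t, f, hc, hf0, hf1, hfs, hfd⟩ := exists_partitionOfUnity_closedBall (d := d) R R⁻¹ hRi
  have hfb : ∀ (c : t) z, ‖f c z‖ ≤ 1 := fun c z => by
    rw [Real.norm_of_nonneg (hf0 c z)]
    exact (Finset.single_le_sum (fun c _ => hf0 c z) (Finset.mem_univ c)).trans (hf1 z)
  have hlim : Tendsto (fun n : ℕ => ENNReal.ofReal R * ∑ c : t, ∫⁻ x : Fin n → X,
      ENNReal.ofReal |∫ z, f c z ∂(sumLaw C D x) - ∫ z, f c z ∂G| ∂(Measure.pi fun _ => P))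
      atTop (𝓝 0) := by
    have := tendsto_finsetSum (Finset.univ : Finset t) fun c _ =>
      tendsto_lintegral_abs_sub hL h0 G hG (f c).continuous (hfb c)
    simpa using ENNReal.Tendsto.const_mul this (Or.inr ENNReal.ofReal_ne_top)
  filter_upwards [ENNReal.tendsto_nhds_zero.1 hlim _ hδ2] with n hn
  have hms : ∀ c : t, Measurable fun x : Fin n → X =>
      ENNReal.ofReal |∫ z, f c z ∂(sumLaw C D x) - ∫ z, f c z ∂G| := fun c => by
    have := (StronglyMeasurable.integral_kernel (κ := sumKernel C D n)
      (f c).continuous.stronglyMeasurable).measurable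
    exact ((this.sub_const _).abs).ennreal_ofReal
  have hmm : Measurable fun x : Fin n → X => secondMoment (sumLaw C D x) :=
    Measurable.lintegral_kernel (κ := sumKernel C D n) (by fun_prop)
  -- `lipDist` is an uncountable supremum; only monotonicity of the integral is applied to it, so
  -- its measurability in x is not needed.
  calc ∫⁻ x : Fin n → X, lipDist (sumLaw C D x) G ∂(Measure.pi fun _ => P)
      ≤ ∫⁻ x : Fin n → X, ((ENNReal.ofReal R⁻¹ + secondMoment (sumLaw C D x) / ENNReal.ofReal R) +
        (ENNReal.ofReal R⁻¹ + secondMoment G / ENNReal.ofReal R) + ENNReal.ofReal R *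
        ∑ c : t, ENNReal.ofReal |∫ z, f c z ∂(sumLaw C D x) - ∫ z, f c z ∂G|)
          ∂(Measure.pi fun _ => P) :=
        lintegral_mono fun x => lipDist_le hR hc hf0 hf1 hfs hfd hRi _ _
    _ = (ENNReal.ofReal R⁻¹ + (∫⁻ x : Fin n → X, secondMoment (sumLaw C D x)
          ∂(Measure.pi fun _ => P)) / ENNReal.ofReal R) +
        (ENNReal.ofReal R⁻¹ + secondMoment G / ENNReal.ofReal R) + ENNReal.ofReal R *
        ∑ c : t, ∫⁻ x : Fin n → X,
          ENNReal.ofReal |∫ z, f c z ∂(sumLaw C D x) - ∫ z, f c z ∂G|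
            ∂(Measure.pi fun _ => P) := by
        simp only [div_eq_mul_inv]
        rw [lintegral_add_right _ (by fun_prop), lintegral_add_right _ (by fun_prop),
          lintegral_add_right _ (by fun_prop), lintegral_mul_const _ hmm,
          lintegral_const_mul _ (by fun_prop), lintegral_finsetSum _ fun c _ => hms c]
        simp
    _ ≤ (ENNReal.ofReal R⁻¹ + m / ENNReal.ofReal R) +
        (ENNReal.ofReal R⁻¹ + secondMoment G / ENNReal.ofReal R) + δ / 2 := by
        gcongr
        exact lintegral_secondMoment_sumLaw_le hD hL h0 n
    _ ≤ δ / 2 + δ / 2 := by gcongr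
    _ = δ := ENNReal.add_halves δ

end SecondMoment
-- Consequences of quadratic mean differentiability.
section QMD

variable {S : Type*} [MeasurableSpace S] {d : ℕ} {ν : Measure S}
  {p : EuclideanSpace ℝ (Fin d) → S → ℝ} {θ : EuclideanSpace ℝ (Fin d)}
  {η : S → EuclideanSpace ℝ (Fin d)}

lemma tendsto_smul_nhdsGT_zero (v : EuclideanSpace ℝ (Fin d)) :
    Tendsto (fun t : ℝ => t • v) (𝓝[>] 0) (𝓝 0) := by
  have : Tendsto (fun t : ℝ => t • v) (𝓝 0) (𝓝 ((0 : ℝ) • v)) :=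
    (continuous_id.smul continuous_const).tendsto 0
  rw [zero_smul] at this
  exact this.mono_left nhdsWithin_le_nhds

lemma memLp_sqrt {q : S → ℝ} (hm : Measurable q) (h0 : ∀ z, 0 ≤ q z) (hi : Integrable q ν) :
    MemLp (fun z => √(q z)) 2 ν := by
  rw [memLp_two_iff_integrable_sq hm.sqrt.aestronglyMeasurable]
  simpa only [Real.sq_sqrt (h0 _)] using hi

/-- For one small t > 0, t η_k is an increment of root densities minus the remainder, and all three
terms are in L². -/
lemma IsQMDeriv.memLp (h : IsQMDeriv ν p θ η) {Θ : Set (EuclideanSpace ℝ (Fin d))}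
    (hΘ : IsOpen Θ) (hθ : θ ∈ Θ) (hm : ∀ θ' ∈ Θ, Measurable (p θ'))
    (h0 : ∀ θ' ∈ Θ, ∀ z, 0 ≤ p θ' z) (hi : ∀ θ' ∈ Θ, Integrable (p θ') ν) : MemLp η 2 ν := by
  refine MemLp.of_eval_piLp fun k => ?_
  set v : EuclideanSpace ℝ (Fin d) := EuclideanSpace.single k 1
  have hnear : ∀ᶠ t : ℝ in 𝓝[>] 0, θ + t • v ∈ Θ := by
    have : Tendsto (fun t : ℝ => θ + t • v) (𝓝[>] 0) (𝓝 (θ + 0)) :=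
      (tendsto_smul_nhdsGT_zero v).const_add θ
    rw [add_zero] at this
    exact this.eventually (hΘ.mem_nhds hθ)
  obtain ⟨t, ⟨ht, hq⟩, htpos⟩ := ((hnear.and ((tendsto_smul_nhdsGT_zero v).eventually
    (h.2 1 one_pos))).and self_mem_nhdsWithin).exists
  have htp : (0 : ℝ) < t := htpos
  have hηm := h.1
  have m1 := memLp_sqrt (hm _ ht) (h0 _ ht) (hi _ ht)
  have m2 := memLp_sqrt (hm _ hθ) (h0 _ hθ) (hi _ hθ)
  have mr : MemLp (fun z => √(p (θ + t • v) z) - √(p θ z) - inner ℝ (t • v) (η z)) 2 ν := by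
    have hmeas : Measurable fun z =>
        √(p (θ + t • v) z) - √(p θ z) - inner ℝ (t • v) (η z) :=
      ((hm _ ht).sqrt.sub (hm _ hθ).sqrt).sub (by fun_prop)
    rw [memLp_two_iff_integrable_sq hmeas.aestronglyMeasurable]
    refine ⟨(hmeas.pow_const 2).aestronglyMeasurable, ?_⟩
    rw [hasFiniteIntegral_iff_ofReal (.of_forall fun z => sq_nonneg _)]
    exact hq.trans_lt ENNReal.ofReal_lt_top
  have := ((m1.sub m2).sub mr).const_mul t⁻¹
  convert! this using 1
  ext z
  simp only [Pi.sub_apply, real_inner_smul_left, sub_sub_cancel, v,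
    EuclideanSpace.inner_single_left]
  field_simp
  simp

/-- Where p(θ) = 0 the root density is at its minimum. If ⟨v, η⟩ < 0 there, the remainder in
direction t v is at least t |⟨v, η⟩|; dividing its squared integral by t² and letting ε → 0 leaves a
null set. -/
lemma IsQMDeriv.ae_inner_nonneg (h : IsQMDeriv ν p θ η) (hm : Measurable (p θ))
    (v : EuclideanSpace ℝ (Fin d)) : ∀ᵐ z ∂ν, p θ z = 0 → 0 ≤ inner ℝ v (η z) := by
  set A : Set S := {z | p θ z = 0 ∧ inner ℝ v (η z) < 0} with hA
  have hηm := h.1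
  have hAm : MeasurableSet A :=
    (measurableSet_eq_fun hm measurable_const).inter
      (measurableSet_lt (g := fun _ => (0 : ℝ)) (measurable_const.inner hηm) measurable_const)
  have hle : ∀ ε : ℝ, 0 < ε →
      ∫⁻ z in A, ENNReal.ofReal ((inner ℝ v (η z)) ^ 2) ∂ν ≤ ENNReal.ofReal (ε * ‖v‖ ^ 2) := by
    intro ε hε
    obtain ⟨t, hq, htpos⟩ := (((tendsto_smul_nhdsGT_zero v).eventually (h.2 ε hε)).and
      self_mem_nhdsWithin).exists
    have htp : (0 : ℝ) < t := htpos
    have ht2 : 0 < t ^ 2 := by positivity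
    have key : ENNReal.ofReal (t ^ 2) * ∫⁻ z in A, ENNReal.ofReal ((inner ℝ v (η z)) ^ 2) ∂ν ≤
        ENNReal.ofReal (t ^ 2) * ENNReal.ofReal (ε * ‖v‖ ^ 2) := by
      rw [← lintegral_const_mul _ (by fun_prop), ← ENNReal.ofReal_mul ht2.le]
      have e : ε * ‖t • v‖ ^ 2 = t ^ 2 * (ε * ‖v‖ ^ 2) := by
        rw [norm_smul, Real.norm_of_nonneg htp.le]
        ring
      rw [e] at hq
      refine le_trans ?_ hq
      refine le_trans (setLIntegral_mono' hAm fun z hz => ?_) (setLIntegral_le_lintegral A _)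
      rw [← ENNReal.ofReal_mul ht2.le]
      refine ENNReal.ofReal_le_ofReal ?_
      rw [hz.1, Real.sqrt_zero, sub_zero, real_inner_smul_left]
      -- The real square root is nonnegative everywhere, so θ + t v need not lie in the parameter
      -- set.
      have h1 := Real.sqrt_nonneg (p (θ + t • v) z)
      have h2 : 0 ≤ -(t * inner ℝ v (η z)) := by
        have := hz.2
        nlinarith
      nlinarith
    exact (ENNReal.mul_le_mul_iff_right (by simpa using ht2.ne') ENNReal.ofReal_ne_top).1 key
  have hz : ∫⁻ z in A, ENNReal.ofReal ((inner ℝ v (η z)) ^ 2) ∂ν = 0 := by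
    have hlim : Tendsto (fun ε : ℝ => ENNReal.ofReal (ε * ‖v‖ ^ 2)) (𝓝[>] 0) (𝓝 0) := by
      have : Tendsto (fun ε : ℝ => ENNReal.ofReal (ε * ‖v‖ ^ 2)) (𝓝 0)
          (𝓝 (ENNReal.ofReal (0 * ‖v‖ ^ 2))) :=
        (ENNReal.continuous_ofReal.comp (continuous_id.mul continuous_const)).tendsto 0
      rw [zero_mul, ENNReal.ofReal_zero] at this
      exact this.mono_left nhdsWithin_le_nhds
    refine le_antisymm (ge_of_tendsto hlim ?_) zero_le
    filter_upwards [self_mem_nhdsWithin] with ε hε using hle ε hε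
  rw [lintegral_eq_zero_iff (by fun_prop), EventuallyEq, ae_restrict_iff' hAm] at hz
  filter_upwards [hz] with z hz hp
  by_contra! hneg
  have := hz ⟨hp, hneg⟩
  simp only [Pi.zero_apply, ENNReal.ofReal_eq_zero] at this
  nlinarith

lemma IsQMDeriv.ae_eq_zero (h : IsQMDeriv ν p θ η) (hm : Measurable (p θ)) :
    ∀ᵐ z ∂ν, p θ z = 0 → η z = 0 := by
  have h1 := fun k : Fin d => h.ae_inner_nonneg hm (EuclideanSpace.single k 1)
  have h2 := fun k : Fin d => h.ae_inner_nonneg hm (EuclideanSpace.single k (-1))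
  filter_upwards [ae_all_iff.2 h1, ae_all_iff.2 h2] with z h1 h2 hp
  ext k
  have a := h1 k hp
  have b := h2 k hp
  simp only [EuclideanSpace.inner_single_left, map_one, map_neg, one_mul, neg_mul] at a b
  simp only [PiLp.zero_apply]
  linarith

end QMD

/-! ### Second moments of scores. -/

section Score

variable {S : Type*} [MeasurableSpace S] {d : ℕ} {ν : Measure S} {p : S → ℝ}
  {η : S → EuclideanSpace ℝ (Fin d)}

lemma measurable_score (hp : Measurable p) (hη : Measurable η) : Measurable (score p η) := by
  unfold score
  fun_prop

lemma integral_law {F : Type*} [NormedAddCommGroup F] [NormedSpace ℝ F] (hp : Measurable p)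
    (h0 : ∀ z, 0 ≤ p z) (g : S → F) : ∫ z, g z ∂(law ν p) = ∫ z, p z • g z ∂ν := by
  rw [law, integral_withDensity_eq_integral_toReal_smul (by fun_prop) (by simp)]
  simp_rw [ENNReal.toReal_ofReal (h0 _)]

lemma setIntegral_law {F : Type*} [NormedAddCommGroup F] [NormedSpace ℝ F] (hp : Measurable p)
    (h0 : ∀ z, 0 ≤ p z) (g : S → F) {A : Set S} (hA : MeasurableSet A) :
    ∫ z in A, g z ∂(law ν p) = ∫ z in A, p z • g z ∂ν := by
  rw [law, restrict_withDensity hA]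
  exact integral_law hp h0 g

lemma integrable_law_iff {F : Type*} [NormedAddCommGroup F] [NormedSpace ℝ F] (hp : Measurable p)
    (h0 : ∀ z, 0 ≤ p z) {g : S → F} :
    Integrable g (law ν p) ↔ Integrable (fun z => p z • g z) ν := by
  rw [law, integrable_withDensity_iff_integrable_smul' (by fun_prop) (by simp)]
  simp_rw [ENNReal.toReal_ofReal (h0 _)]

-- The score is 0 where p = 0, since division by zero gives 0; the identity therefore needs η = 0
-- there.
omit [MeasurableSpace S] in
lemma mul_score_mul_score (h0 : ∀ z, 0 ≤ p z) {z : S} (hz : p z = 0 → η z = 0) (i j : Fin d) :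
    p z * (score p η z i * score p η z j) = 4 * (η z i * η z j) := by
  rcases (h0 z).eq_or_lt with h | h
  · simp [hz h.symm, ← h]
  · have hs : √(p z) ^ 2 = p z := Real.sq_sqrt h.le
    have hs0 : √(p z) ≠ 0 := (Real.sqrt_pos.2 h).ne'
    simp only [score, PiLp.smul_apply, smul_eq_mul]
    nth_rw 1 [← hs]
    field_simp
    ring

lemma integral_score_mul_score (hp : Measurable p) (h0 : ∀ z, 0 ≤ p z)
    (hz : ∀ᵐ z ∂ν, p z = 0 → η z = 0) (i j : Fin d) :
    ∫ z, score p η z i * score p η z j ∂(law ν p) = fisherInfo ν η i j := by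
  rw [integral_law hp h0, fisherInfo, Matrix.of_apply, ← integral_const_mul]
  refine integral_congr_ae ?_
  filter_upwards [hz] with z hz
  exact mul_score_mul_score h0 hz i j

lemma memLp_score (hp : Measurable p) (h0 : ∀ z, 0 ≤ p z) (hηm : Measurable η)
    (hη : MemLp η 2 ν) (hz : ∀ᵐ z ∂ν, p z = 0 → η z = 0) : MemLp (score p η) 2 (law ν p) := by
  refine MemLp.of_eval_piLp fun k => ?_
  have hmk : Measurable fun z => score p η z k := by
    have := measurable_score hp hηm
    fun_prop
  rw [memLp_two_iff_integrable_sq hmk.aestronglyMeasurable, integrable_law_iff hp h0]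
  have hk : MemLp (fun z => η z k) 2 ν := (EuclideanSpace.proj (𝕜 := ℝ) k).comp_memLp' hη
  refine (hk.integrable_sq.const_mul 4).congr ?_
  filter_upwards [hz] with z hz
  have := mul_score_mul_score h0 hz k k
  simp only [smul_eq_mul, sq]
  exact this.symm

end Score

/-! ### The marginal score as a conditional mean. -/

section Marginal

variable {X Y : Type*} [MeasurableSpace X] [MeasurableSpace Y] {d : ℕ}
  {νX : Measure X} [SFinite νX] {κ : Kernel X Y} [IsSFiniteKernel κ]
  {p : X × Y → ℝ} {η : X × Y → EuclideanSpace ℝ (Fin d)}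

lemma measurable_margDensity (hp : Measurable p) : Measurable (margDensity κ p) :=
  (hp.stronglyMeasurable.integral_kernel_prod_right').measurable

omit [IsSFiniteKernel κ] in
lemma margDensity_nonneg (h0 : ∀ z, 0 ≤ p z) (x : X) : 0 ≤ margDensity κ p x :=
  integral_nonneg fun _ => h0 _

lemma measurable_margDeriv (hp : Measurable p) (hη : Measurable η) :
    Measurable (margDeriv κ p η) := by
  classical
  have hm := measurable_margDensity (κ := κ) hp
  unfold margDeriv
  refine Measurable.ite (measurableSet_lt measurable_const hm) ?_ measurable_const
  have : Measurable fun z : X × Y => (√(p z) / √(margDensity κ p z.1)) • η z := by fun_prop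
  exact (this.stronglyMeasurable.integral_kernel_prod_right').measurable

lemma measurable_margScore (hp : Measurable p) (hη : Measurable η) :
    Measurable (margScore κ p η) :=
  measurable_score (measurable_margDensity hp) (measurable_margDeriv hp hη)

lemma fst_law (hp : Measurable p) (h0 : ∀ z, 0 ≤ p z) (hi : Integrable p (νX ⊗ₘ κ)) :
    (law (νX ⊗ₘ κ) p).fst = law νX (margDensity κ p) := by
  ext A hA
  have hA' : Prod.fst ⁻¹' A = A ×ˢ (Set.univ : Set Y) := by ext; simp
  rw [Measure.fst_apply hA, law, withDensity_apply _ (measurable_fst hA), hA',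
    Measure.setLIntegral_compProd (by fun_prop) hA .univ, law, withDensity_apply _ hA]
  refine lintegral_congr_ae (ae_restrict_of_ae ?_)
  filter_upwards [((Measure.integrable_compProd_iff hi.aestronglyMeasurable).1 hi).1] with x hx
  rw [Measure.restrict_univ, margDensity, ofReal_integral_eq_lintegral_ofReal hx
    (.of_forall fun _ => h0 _)]

/-- The marginal score is, up to the marginal density, the integral of the full score. -/
lemma ae_margDensity_smul_margScore (h0 : ∀ z, 0 ≤ p z) (hi : Integrable p (νX ⊗ₘ κ)) :
    ∀ᵐ x ∂νX, margDensity κ p x • margScore κ p η x = ∫ y, p (x, y) • score p η (x, y) ∂(κ x) := by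
  filter_upwards [((Measure.integrable_compProd_iff hi.aestronglyMeasurable).1 hi).1] with x hx
  rcases (margDensity_nonneg (κ := κ) h0 x).eq_or_lt with h | h
  -- If p(x) = 0 then p(x, y) = 0 for κ(x)-almost all y, and both sides vanish.
  · rw [← h, zero_smul]
    have hz := (integral_eq_zero_iff_of_nonneg (fun y => h0 (x, y)) hx).1 h.symm
    symm
    refine integral_eq_zero_of_ae ?_
    filter_upwards [hz] with y hy
    simp only [Pi.zero_apply] at hy
    simp [hy]
  · rw [margScore, score, margDeriv, if_pos h, ← integral_smul, ← integral_smul]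
    refine integral_congr_ae (.of_forall fun y => ?_)
    have hs : √(margDensity κ p x) ^ 2 = margDensity κ p x := Real.sq_sqrt h.le
    have hs0 : √(margDensity κ p x) ≠ 0 := (Real.sqrt_pos.2 h).ne'
    simp only [score, smul_smul]
    congr 1
    nth_rw 1 [← hs]
    rcases (h0 (x, y)).eq_or_lt with hp0 | hp0
    · simp [← hp0]
    · have ht : √(p (x, y)) ^ 2 = p (x, y) := Real.sq_sqrt hp0.le
      have ht0 : √(p (x, y)) ≠ 0 := (Real.sqrt_pos.2 hp0).ne'
      nth_rw 2 [← ht]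
      field_simp

variable {C : Kernel X Y} [IsMarkovKernel C]

lemma integrable_integral_compProd {F : Type*} [NormedAddCommGroup F] [NormedSpace ℝ F]
    {α β : Type*} [MeasurableSpace α] [MeasurableSpace β] {m : Measure α} [SFinite m]
    {K : Kernel α β} [IsSFiniteKernel K] {f : α × β → F} (hf : Integrable f (m ⊗ₘ K)) :
    Integrable (fun x => ∫ y, f (x, y) ∂(K x)) m :=
  Integrable.integral_compProd (κ := Kernel.const Unit m) (η := Kernel.prodMkLeft Unit K)
    (a := ()) hf

/-- The marginal score is the conditional mean of the full score. -/
lemma ae_margScore_eq_integral (hp : Measurable p) (h0 : ∀ z, 0 ≤ p z)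
    [hprob : IsProbabilityMeasure (law (νX ⊗ₘ κ) p)]
    (hi : Integrable p (νX ⊗ₘ κ)) (hS : MemLp (score p η) 2 (law (νX ⊗ₘ κ) p))
    (hC : (law (νX ⊗ₘ κ) p).fst ⊗ₘ C = law (νX ⊗ₘ κ) p) :
    ∀ᵐ x ∂(law (νX ⊗ₘ κ) p).fst, margScore κ p η x = ∫ y, score p η (x, y) ∂(C x) := by
  have hS1 := hS.integrable one_le_two
  have hSν : Integrable (fun z => p z • score p η z) (νX ⊗ₘ κ) := (integrable_law_iff hp h0).1 hS1
  have hSC : Integrable (score p η) ((law (νX ⊗ₘ κ) p).fst ⊗ₘ C) := by rwa [hC]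
  have hmd := measurable_margDensity (κ := κ) hp
  have hae := ae_margDensity_smul_margScore (η := η) h0 hi
  -- Both sides have the same integral over every A, namely that of the full score over A × Y.
  refine Integrable.ae_eq_of_forall_setIntegral_eq _ _ ?_ (integrable_integral_compProd hSC) ?_
  · rw [fst_law hp h0 hi, integrable_law_iff hmd (margDensity_nonneg h0)]
    exact (integrable_integral_compProd hSν).congr (hae.mono fun x hx => hx.symm)
  · intro A hA _
    have e1 : ∫ x in A, margScore κ p η x ∂(law (νX ⊗ₘ κ) p).fst =
        ∫ z in A ×ˢ Set.univ, p z • score p η z ∂(νX ⊗ₘ κ) := by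
      rw [fst_law hp h0 hi, setIntegral_law hmd (margDensity_nonneg h0) _ hA,
        Measure.setIntegral_compProd hA .univ hSν.integrableOn]
      refine integral_congr_ae (ae_restrict_of_ae ?_)
      simpa only [Measure.restrict_univ] using hae
    have e2 : ∫ x in A, ∫ y, score p η (x, y) ∂(C x) ∂(law (νX ⊗ₘ κ) p).fst =
        ∫ z in A ×ˢ Set.univ, score p η z ∂(law (νX ⊗ₘ κ) p) := by
      have := Measure.setIntegral_compProd hA .univ hSC.integrableOn
      rw [hC] at this
      simpa only [Measure.restrict_univ] using this.symm
    rw [e1, e2, setIntegral_law hp h0 _ (hA.prod .univ)]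

/-- The marginal derivative is 0 by definition where the marginal density vanishes, so no
differentiability of the marginal model enters. -/
lemma integral_margScore_mul_margScore (hp : Measurable p) (h0 : ∀ z, 0 ≤ p z)
    (hi : Integrable p (νX ⊗ₘ κ)) (i j : Fin d) :
    ∫ x, margScore κ p η x i * margScore κ p η x j ∂(law (νX ⊗ₘ κ) p).fst =
      fisherInfo νX (margDeriv κ p η) i j := by
  rw [fst_law hp h0 hi]
  refine integral_score_mul_score (measurable_margDensity hp) (margDensity_nonneg h0)
    (.of_forall fun x hx => ?_) i j
  rw [margDeriv, if_neg (by simp [hx])]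

end Marginal

/-! ### Conditional centring and the decomposition of second moments. -/

section Centering

variable {X Y : Type*} [MeasurableSpace X] [MeasurableSpace Y] {d : ℕ}
  {P : Measure X} [IsProbabilityMeasure P] {C : Kernel X Y} [IsMarkovKernel C]
  {V : X × Y → EuclideanSpace ℝ (Fin d)} {m : X → EuclideanSpace ℝ (Fin d)}

/-- Conditional Jensen: ‖m(x)‖² is at most the conditional mean of ‖V‖². -/
lemma memLp_condMean (hV : MemLp V 2 (P ⊗ₘ C)) (hVm : Measurable V) (hm : Measurable m)
    (he : ∀ᵐ x ∂P, m x = ∫ y, V (x, y) ∂(C x)) : MemLp m 2 P := by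
  have hsq := hV.norm.integrable_sq
  rw [memLp_two_iff_integrable_sq_norm hm.aestronglyMeasurable]
  refine (integrable_integral_compProd hsq).mono' (by fun_prop) ?_
  filter_upwards [he, ((Measure.integrable_compProd_iff hsq.aestronglyMeasurable).1 hsq).1]
    with x hx hxi
  have hL : MemLp (fun y => ‖V (x, y)‖) 2 (C x) :=
    ((memLp_two_iff_integrable_sq_norm
      (hVm.comp measurable_prodMk_left).aestronglyMeasurable).2 hxi).norm
  have hv := variance_nonneg (fun y => ‖V (x, y)‖) (C x)
  rw [variance_eq_sub hL] at hv
  rw [Real.norm_of_nonneg (sq_nonneg _), hx]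
  have h1 : ‖∫ y, V (x, y) ∂(C x)‖ ^ 2 ≤ (∫ y, ‖V (x, y)‖ ∂(C x)) ^ 2 :=
    pow_le_pow_left₀ (norm_nonneg _) (norm_integral_le_integral_norm _) 2
  simp only [Pi.pow_apply] at hv
  linarith

lemma memLp_condMean_fst (hV : MemLp V 2 (P ⊗ₘ C)) (hVm : Measurable V) (hm : Measurable m)
    (he : ∀ᵐ x ∂P, m x = ∫ y, V (x, y) ∂(C x)) :
    MemLp (fun z : X × Y => m z.1) 2 (P ⊗ₘ C) := by
  have := memLp_condMean hV hVm hm he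
  refine this.comp_measurePreserving ⟨measurable_fst, ?_⟩
  exact Measure.fst_compProd P C

lemma ae_integral_sub_condMean (hV : MemLp V 2 (P ⊗ₘ C))
    (he : ∀ᵐ x ∂P, m x = ∫ y, V (x, y) ∂(C x)) :
    ∀ᵐ x ∂P, ∫ y, (V (x, y) - m x) ∂(C x) = 0 := by
  have hi := (Measure.integrable_compProd_iff hV.aestronglyMeasurable).1 (hV.integrable one_le_two)
  filter_upwards [he, hi.1] with x hx hxi
  rw [integral_sub hxi (integrable_const _), hx]
  simp

/-- The matrix of second moments of the conditionally centred variable. -/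
lemma integral_sub_condMean_mul (hV : MemLp V 2 (P ⊗ₘ C)) (hVm : Measurable V) (hm : Measurable m)
    (he : ∀ᵐ x ∂P, m x = ∫ y, V (x, y) ∂(C x)) (i j : Fin d) :
    ∫ z, (V z - m z.1) i * (V z - m z.1) j ∂(P ⊗ₘ C) =
      ∫ z, V z i * V z j ∂(P ⊗ₘ C) - ∫ x, m x i * m x j ∂P := by
  have hM := memLp_condMean_fst hV hVm hm he
  have hc : ∀ {W : X × Y → EuclideanSpace ℝ (Fin d)} (k : Fin d), MemLp W 2 (P ⊗ₘ C) →
      MemLp (fun z => W z k) 2 (P ⊗ₘ C) := fun k hW =>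
    (EuclideanSpace.proj (𝕜 := ℝ) k).comp_memLp' hW
  -- Conditioning on x replaces V by m in the cross terms, so they all equal the second moments of
  -- m.
  have hcross : ∀ k l : Fin d, ∫ z : X × Y, V z k * m z.1 l ∂(P ⊗ₘ C) = ∫ x, m x k * m x l ∂P := by
    intro k l
    have hkl : Integrable (fun z : X × Y => V z k * m z.1 l) (P ⊗ₘ C) :=
      (hc k hV).integrable_mul (hc l hM)
    rw [Measure.integral_compProd hkl]
    refine integral_congr_ae ?_
    have hi := (Measure.integrable_compProd_iff hV.aestronglyMeasurable).1
      (hV.integrable one_le_two)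
    filter_upwards [he, hi.1] with x hx hxi
    rw [integral_mul_const]
    congr 1
    have := (EuclideanSpace.proj (𝕜 := ℝ) k).integral_comp_comm hxi
    rw [hx]
    exact this
  have i4 : Integrable (fun z : X × Y => m z.1 i * m z.1 j) (P ⊗ₘ C) :=
    (hc i hM).integrable_mul (hc j hM)
  have hmm : ∫ z : X × Y, m z.1 i * m z.1 j ∂(P ⊗ₘ C) = ∫ x, m x i * m x j ∂P := by
    rw [Measure.integral_compProd i4]
    simp
  have e : ∀ z : X × Y, (V z - m z.1) i * (V z - m z.1) j =
      (V z i * V z j - V z i * m z.1 j) - (V z j * m z.1 i - m z.1 i * m z.1 j) := fun z => by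
    simp only [PiLp.sub_apply]
    ring
  simp_rw [e]
  have i1 : Integrable (fun z : X × Y => V z i * V z j) (P ⊗ₘ C) :=
    (hc i hV).integrable_mul (hc j hV)
  have i2 : Integrable (fun z : X × Y => V z i * m z.1 j) (P ⊗ₘ C) :=
    (hc i hV).integrable_mul (hc j hM)
  have i3 : Integrable (fun z : X × Y => V z j * m z.1 i) (P ⊗ₘ C) :=
    (hc j hV).integrable_mul (hc i hM)
  have i12 : Integrable (fun z : X × Y => V z i * V z j - V z i * m z.1 j) (P ⊗ₘ C) := i1.sub i2
  have i34 : Integrable (fun z : X × Y => V z j * m z.1 i - m z.1 i * m z.1 j) (P ⊗ₘ C) :=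
    i3.sub i4
  rw [integral_sub i12 i34, integral_sub i1 i2, integral_sub i3 i4, hcross, hcross,
    hmm]
  have : ∫ x, m x j * m x i ∂P = ∫ x, m x i * m x j ∂P := by simp_rw [mul_comm]
  rw [this]
  ring

end Centering

/-! ### Quadratic forms of a second moment matrix. -/

section SecondMomentMatrix

variable {S : Type*} [MeasurableSpace S] {d : ℕ} {M : Measure S}
  {D : S → EuclideanSpace ℝ (Fin d)} {J : Matrix (Fin d) (Fin d) ℝ}

lemma integral_inner_sq (hD : MemLp D 2 M) (hJ : ∀ i j, ∫ z, D z i * D z j ∂M = J i j)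
    (t : EuclideanSpace ℝ (Fin d)) :
    ∫ z, (inner ℝ (D z) t) ^ 2 ∂M = t.ofLp ⬝ᵥ J.mulVec t.ofLp := by
  have hc : ∀ k : Fin d, MemLp (fun z => D z k) 2 M := fun k =>
    (EuclideanSpace.proj (𝕜 := ℝ) k).comp_memLp' hD
  have hij : ∀ i j : Fin d, Integrable (fun z => t i * t j * (D z i * D z j)) M := fun i j =>
    ((hc i).integrable_mul (hc j)).const_mul _
  have e : ∀ z, (inner ℝ (D z) t) ^ 2 = ∑ i, ∑ j, t i * t j * (D z i * D z j) := fun z => by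
    simp only [PiLp.inner_apply, sq, Finset.sum_mul_sum]
    refine Finset.sum_congr rfl fun i _ => Finset.sum_congr rfl fun j _ => ?_
    simp only [RCLike.inner_apply, conj_trivial]
    ring
  simp_rw [e]
  rw [integral_finsetSum _ fun i _ => integrable_finsetSum _ fun j _ => hij i j]
  simp only [dotProduct, Matrix.mulVec, Finset.mul_sum]
  refine Finset.sum_congr rfl fun i _ => ?_
  rw [integral_finsetSum _ fun j _ => hij i j]
  refine Finset.sum_congr rfl fun j _ => ?_
  rw [integral_const_mul, hJ]
  ring

/-- Needed because the characteristic function formula for `multivariateGaussian` assumes a positive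
semidefinite matrix. -/
lemma posSemidef_of_integral_mul (hD : MemLp D 2 M)
    (hJ : ∀ i j, ∫ z, D z i * D z j ∂M = J i j) : J.PosSemidef := by
  refine Matrix.PosSemidef.of_dotProduct_mulVec_nonneg ?_ fun x => ?_
  · ext i j
    simp only [Matrix.conjTranspose_apply, star_trivial]
    rw [← hJ, ← hJ]
    simp_rw [mul_comm]
  · have := integral_inner_sq hD hJ (WithLp.toLp 2 x)
    simp only [star_trivial]
    rw [← this]
    exact integral_nonneg fun _ => sq_nonneg _

end SecondMomentMatrix

end PartialScore

end

/-! ### The conditional central limit theorem applied to the partial score. -/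

open PartialScore

theorem mainTheorem3 {X Y : Type*} [MeasurableSpace X] [MeasurableSpace Y] {d : ℕ}
    (Θ : Set (EuclideanSpace ℝ (Fin d))) (hΘ : IsOpen Θ)
    -- the dominating measure and its disintegration
    (ν : Measure (X × Y)) [SigmaFinite ν] (νX : Measure X) [SFinite νX]
    (κ : Kernel X Y) [IsSFiniteKernel κ] (hν : ν = νX.compProd κ)
    -- the densities of the full model
    (p : EuclideanSpace ℝ (Fin d) → X × Y → ℝ)
    (hp_meas : Measurable fun q : Θ × (X × Y) => p q.1 q.2)
    (hp_nonneg : ∀ θ ∈ Θ, ∀ z, 0 ≤ p θ z)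
    (hp_prob : ∀ θ ∈ Θ, IsProbabilityMeasure (PartialScore.law ν (p θ)))
    -- quadratic mean differentiability and mutual absolute continuity of the full model
    (η : EuclideanSpace ℝ (Fin d) → X × Y → EuclideanSpace ℝ (Fin d))
    (hη : ∀ θ ∈ Θ, PartialScore.IsQMDeriv ν p θ (η θ))
    (hac : ∀ A : Set (X × Y), MeasurableSet A → ∀ θ₁ ∈ Θ, ∀ θ₂ ∈ Θ,
      (0 < PartialScore.law ν (p θ₁) A ↔ 0 < PartialScore.law ν (p θ₂) A))
    -- continuity of the full Fisher information
    (hK : ContinuousOn (fun θ => PartialScore.fisherInfo ν (η θ)) Θ)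
    (θ : EuclideanSpace ℝ (Fin d)) (hθ : θ ∈ Θ)
    (hJ : (PartialScore.partialInfo ν νX κ (p θ) (η θ)).det ≠ 0)
    -- the conditional law of `y` given `x`
    (C : Kernel X Y) [IsMarkovKernel C] (hC : (PartialScore.law ν (p θ)).IsCondKernel C) :
    Tendsto
      (fun n : ℕ =>
        ∫⁻ x : Fin n → X,
          PartialScore.lipDist (PartialScore.partialLaw κ C (p θ) (η θ) x)
            (multivariateGaussian 0 (PartialScore.partialInfo ν νX κ (p θ) (η θ)))
          ∂(Measure.pi fun _ : Fin n => (PartialScore.law ν (p θ)).fst))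
      atTop (𝓝 0) := by
  subst hν
  have hm : ∀ θ' ∈ Θ, Measurable (p θ') := fun θ' h =>
    hp_meas.comp (measurable_prodMk_left (x := (⟨θ', h⟩ : Θ)))
  have hi : ∀ θ' ∈ Θ, Integrable (p θ') (νX ⊗ₘ κ) := fun θ' h => by
    have := hp_prob θ' h
    have h1 := (integrable_law_iff (hm θ' h) (hp_nonneg θ' h)).1
      (integrable_const (1 : ℝ) (μ := law (νX ⊗ₘ κ) (p θ')))
    simpa using h1
  have hprob := hp_prob θ hθ
  have hP : (law (νX ⊗ₘ κ) (p θ)).fst ⊗ₘ C = law (νX ⊗ₘ κ) (p θ) := hC.disintegrate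
  have hηm := (hη θ hθ).1
  have hz := (hη θ hθ).ae_eq_zero (hm θ hθ)
  have hS := memLp_score (hm θ hθ) (hp_nonneg θ hθ) hηm
    ((hη θ hθ).memLp hΘ hθ hm hp_nonneg hi) hz
  have he := ae_margScore_eq_integral (hm θ hθ) (hp_nonneg θ hθ) (hi θ hθ) hS hP
  have hSm := measurable_score (hm θ hθ) hηm
  have hsm := measurable_margScore (κ := κ) (hm θ hθ) hηm
  set P := (law (νX ⊗ₘ κ) (p θ)).fst with hPdef
  set S := score (p θ) (η θ)
  set s := margScore κ (p θ) (η θ)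
  set J := partialInfo (νX ⊗ₘ κ) νX κ (p θ) (η θ)
  have hSC : MemLp S 2 (P ⊗ₘ C) := by rwa [hP]
  have hD : MemLp (fun z : X × Y => S z - s z.1) 2 (P ⊗ₘ C) :=
    hSC.sub (memLp_condMean_fst hSC hSm hsm he)
  -- This identifies the limiting covariance: the full information minus that of the conditional
  -- mean is K - I.
  have hcov : ∀ i j, ∫ z, (S z - s z.1) i * (S z - s z.1) j ∂(P ⊗ₘ C) = J i j := fun i j => by
    rw [integral_sub_condMean_mul hSC hSm hsm he, hP,
      integral_score_mul_score (hm θ hθ) (hp_nonneg θ hθ) hz,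
      integral_margScore_mul_margScore (hm θ hθ) (hp_nonneg θ hθ) (hi θ hθ)]
    rfl
  have hG2 : secondMoment (multivariateGaussian 0 J) ≠ ∞ :=
    ((IsGaussian.memLp_two_id (μ := multivariateGaussian 0 J)).norm.integrable_sq).lintegral_lt_top.ne
  have key := tendsto_lintegral_lipDist_sumLaw (P := P) (C := C)
    (D := fun z : X × Y => S z - s z.1) (by fun_prop) hD
    (ae_integral_sub_condMean hSC he) (multivariateGaussian 0 J) (fun t => by
      rw [charFun_multivariateGaussian (posSemidef_of_integral_mul hD hcov),
        integral_inner_sq hD hcov]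
      simp [neg_div]) hG2
  have hlaw : ∀ (n : ℕ) (x : Fin n → X), partialLaw κ C (p θ) (η θ) x =
      sumLaw C (fun z : X × Y => S z - s z.1) x := fun n x => by
    unfold partialLaw sumLaw
    congr 1
    ext1 y
    simp only [partialZ, normalizedSum, ← smul_sub, ← Finset.sum_sub_distrib, S, s]
  simpa only [hlaw] using key
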